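/- All logarithms are to base $2$. For $0<p\le 1/2$ put $\lambda_p=-1-\tfrac12\log p-\tfrac12\log(1-p)\ge 0$ (so $\lambda_{1/2}=0$). For natural numbers $n,k,t$ let $\Gamma^*_{n,k,t}$ be the set of all $k\times n$ matrices over $\mathbb F_2$ in which every row has exactly $t$ ones and whose rows generate a linear code of dimension $k$ (i.e. the generator matrices, of fixed row weight $t$, of $k$-dimensional codes of length $n$). For a linear code $\mathcal C\subseteq\mathbb F_2^n$ let $P_e(\mathcal C)$ be its probability of error over BSC($p$), the binary symmetric channel with crossover probability $p$: the average probability of error under maximum likelihood decoding (the least over all decoders) when the transmitted codeword is uniformly distributed on $\mathcal C$. Fix $0<p\le 1/2$, $\alpha<1/2$ and a function $\omega(n)\to\infty$. If $k>n^\alpha$ and $$\lambda_p\, t\ \le\ \alpha\log n-\tfrac12\log\log n-\omega(n)$$ (for $p<1/2$: $t\le(\alpha/\lambda_p)\log n$ minus the margin $(\tfrac12\log\log n+\omega(n))/\lambda_p=o(\log n)$ when $\omega(n)=o(\log n)$; in particular this allows every $t\le\gamma\log n$ with a constant $\gamma<\alpha/\lambda_p$), then for at least a $1-o(1)$ proportion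 of the generator matrices in $\Gamma^*_{n,k,t}$ the generated code has probability of error $1-o(1)$ over BSC($p$), as $n\to\infty$, uniformly in $k$ and $t$. That is: for every $\varepsilon>0$ there is $N$ such that for all $n\ge N$ and all $k,t$ satisfying the two conditions, at least $(1-\varepsilon)\,|\Gamma^*_{n,k,t}|$ of the matrices in $\Gamma^*_{n,k,t}$ generate a code $\mathcal C$ with $P_e(\mathcal C)\ge 1-\varepsilon$. -/

import Mathlib

open Filter

/-- The transition probability of the binary symmetric channel with crossover probability `p`,
used `n` times: the probability of receiving `y` when `x` is sent. -/
noncomputable def bscProb {n : ℕ} (p : ℝ) (x y : Fin n → ZMod 2) : ℝ :=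
  ∏ i, if y i = x i then 1 - p else p

open Classical in
/-- The average probability of error over BSC(`p`) of the decoder `D` for the linear code `C`,
when the transmitted codeword is uniformly distributed on `C`. -/
noncomputable def avgErrorProb {n : ℕ} (p : ℝ) (C : Submodule (ZMod 2) (Fin n → ZMod 2))
    (D : (Fin n → ZMod 2) → (Fin n → ZMod 2)) : ℝ :=
  (∑ c : C, ∑ y : Fin n → ZMod 2, if D y = (c : Fin n → ZMod 2) then 0 else bscProb p c y) /
    (Nat.card C : ℝ)

/-- The probability of error of the linear code `C` over BSC(`p`): the smallest average
probability of error of a decoder, which is that of a maximum likelihood decoder.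
(The infimum is over a finite nonempty set.) -/
noncomputable def errorProb {n : ℕ} (p : ℝ) (C : Submodule (ZMod 2) (Fin n → ZMod 2)) : ℝ :=
  ⨅ D : (Fin n → ZMod 2) → (Fin n → ZMod 2), avgErrorProb p C D

/-- The linear code generated by the rows of `G`. -/
def rowCode {k n : ℕ} (G : Matrix (Fin k) (Fin n) (ZMod 2)) :
    Submodule (ZMod 2) (Fin n → ZMod 2) :=
  Submodule.span (ZMod 2) (Set.range fun i => G i)

open Classical in
/-- The `k × n` generator matrices over `𝔽₂`, all of whose rows have weight exactly `t`,
of linear codes of dimension `k`. -/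
noncomputable def ldgmEnsemble (n k t : ℕ) : Finset (Matrix (Fin k) (Fin n) (ZMod 2)) :=
  {G | (∀ i, hammingNorm (G i) = t) ∧ Module.finrank (ZMod 2) (rowCode G) = k}

/-- The exponent `λ_p = -1 - (1/2) log₂ p - (1/2) log₂ (1 - p)`; it is `0` at `p = 1/2`. -/
noncomputable def lambdaBSC (p : ℝ) : ℝ :=
  -1 - 1 / 2 * Real.logb 2 p - 1 / 2 * Real.logb 2 (1 - p)

/-! Let `g` be a row of `G` and `e` the noise. If `e` hits at least half of the support of `g`, then
`e + g` is at least as likely as `e`, so the codeword differing from the sent one by `g` explains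
the received word at least as well. If `M` rows do this for most `e`, any decoder is right with
probability at most about `1 / M` (`one_sub_le_errorProb`).

A given row is hit in exactly `s = ⌈t/2⌉` places with a binomial probability `q` of order at least
`2 ^ (-λ_p t) / √t` (`le_binomProb`), and the hypotheses on `k` and `t` force `k q → ∞`. Rows with
disjoint supports give independent events, so by Chebyshev at least `k q / 2` rows are hit in this
way for most `e`, unless too many pairs of rows meet (`one_sub_le_errorProb_rowCode`). Markov's
inequality over the ensemble (`proportion_le_of_bounds`) reduces the theorem to the bound `t² / n`
on the probability that two given rows meet (`sum_rows_meet_le`).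

That bound is the hard point, because linear independence couples the rows. A single row hits a
given column with probability `t / n` by symmetry, so it suffices that two rows hitting the same
column are not positively correlated. This follows from `pairCount_reverse_cauchySchwarz`: the
matrix `A` counting the completions of a pair of vectors to an independent tuple satisfies a reverse
Cauchy–Schwarz inequality, the Lorentzian property of matroids. The proof is a trickle-down
induction. `A` is the sum of the matrices of the contractions by one vector `c`, and the row sums of
the `c`-th one form row `c` of `A`; the inequality for contractions gives `A ≤ A D⁻¹ A` with `D` the
diagonal of row sums. So no eigenvalue of the normalized matrix lies in `(0, 1)`, and connectedness
makes the eigenvalue `1` simple. -/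

open Matrix

/-! ### Linear algebra: reverse Cauchy–Schwarz and the spectral step of the trickle-down argument.
-/

/-- A symmetric form which is nonpositive on some translate `x - τ • 1` and nonnegative at the
all-ones vector satisfies the reverse Cauchy–Schwarz inequality against the all-ones vector. -/
theorem reverse_cauchySchwarz_one {ι : Type*} [Fintype ι] (A : Matrix ι ι ℝ) (hA : A.IsSymm)
    (h1 : 0 ≤ 1 ⬝ᵥ A *ᵥ 1) (x : ι → ℝ) (τ : ℝ)
    (hx : (x - τ • 1) ⬝ᵥ A *ᵥ (x - τ • 1) ≤ 0) :
    (x ⬝ᵥ A *ᵥ x) * (1 ⬝ᵥ A *ᵥ 1) ≤ (x ⬝ᵥ A *ᵥ 1) ^ 2 := by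
  have hs : (1 : ι → ℝ) ⬝ᵥ A *ᵥ x = x ⬝ᵥ A *ᵥ 1 := by
    rw [dotProduct_mulVec, ← mulVec_transpose, hA.eq, dotProduct_comm]
  simp only [mulVec_sub, mulVec_smul, sub_dotProduct, dotProduct_sub, smul_dotProduct,
    dotProduct_smul, smul_eq_mul, hs] at hx
  -- With `S = 1ᵀA1` and `u = xᵀA1`, multiplying `hx` by `S` gives `xᵀAx · S ≤ 2τuS - τ²S² = u² - (u
  -- - τS)²`.
  nlinarith [sq_nonneg (x ⬝ᵥ A *ᵥ 1 - τ * (1 ⬝ᵥ A *ᵥ 1)), mul_nonneg h1 (neg_nonneg.2 hx)]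

/-- An eigenvector with positive eigenvalue of the deflated normalized matrix vanishes. -/
theorem eq_zero_of_deflated_eigenvector {ι : Type*} [Fintype ι] (A : Matrix ι ι ℝ)
    (hsym : A.IsSymm) (h0 : ∀ a b, 0 ≤ A a b) (r : ι → ℝ) (hr : ∀ a, r a = ∑ b, A a b)
    (hA : ∀ x : ι → ℝ, ∑ a, x a * ∑ b, A a b * x b ≤ ∑ c, (∑ b, A c b * x b) ^ 2 / r c)
    (hconn : ∀ f : ι → ℝ, (∀ a b, A a b ≠ 0 → f a = f b) →
      ∀ a b, r a ≠ 0 → r b ≠ 0 → f a = f b)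
    (hT : ∑ a, r a ≠ 0) (e : ι → ℝ) (μ : ℝ) (hμ : 0 < μ)
    (he : ∀ a, ∑ b, (A a b / (√(r a) * √(r b)) - √(r a) * √(r b) / ∑ a, r a) * e b = μ * e a) :
    e = 0 := by
  have hr0 : ∀ a, 0 ≤ r a := fun a => hr a ▸ Finset.sum_nonneg fun b _ => h0 a b
  have hrow : ∀ a, r a = 0 → ∀ b, A a b = 0 := fun a ha b =>
    (Finset.sum_eq_zero_iff_of_nonneg fun b _ => h0 a b).1 ((hr a).symm.trans ha) b
      (Finset.mem_univ _)
  have hsy : ∀ a b, A a b = A b a := fun a b => by rw [← hsym.apply]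
  have hss : ∀ a, √(r a) * √(r a) = r a := fun a => Real.mul_self_sqrt (hr0 a)
  have hs0 : ∀ a, √(r a) = 0 → r a = 0 := fun a h => (Real.sqrt_eq_zero (hr0 a)).1 h
  set T := ∑ a, r a with hTdef
  have hcol : ∀ b, ∑ a, √(r a) * (A a b / (√(r a) * √(r b))) = √(r b) := by
    intro b
    have h1 : ∀ a, √(r a) * (A a b / (√(r a) * √(r b))) = A b a / √(r b) := by
      intro a
      by_cases h : √(r a) = 0
      · rw [hsy b a, hrow a (hs0 a h) b]; simp
      · rw [hsy b a]; rw [mul_div_assoc', mul_div_mul_left _ _ h]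
    simp only [h1]
    rw [← Finset.sum_div, ← hr, Real.div_sqrt]
  -- The vector `√r` is fixed by the normalized matrix and hence killed by the deflated one, so an
  -- eigenvector with `μ ≠ 0` is orthogonal to it.
  have horth : ∑ a, √(r a) * e a = 0 := by
    have h1 : μ * ∑ a, √(r a) * e a = 0 := by
      calc μ * ∑ a, √(r a) * e a = ∑ a, √(r a) * (μ * e a) := by
            rw [Finset.mul_sum]; exact Finset.sum_congr rfl fun a _ => by ring
        _ = ∑ a, ∑ b, (√(r a) * (A a b / (√(r a) * √(r b))) * e b -
              r a * (√(r b) * e b / T)) := by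
            refine Finset.sum_congr rfl fun a _ => ?_
            rw [← he a, Finset.mul_sum]
            refine Finset.sum_congr rfl fun b _ => ?_
            linear_combination -(√(r b) * e b / T) * hss a
        _ = ∑ b, √(r b) * e b - T * ∑ b, (√(r b) * e b / T) := by
            simp only [Finset.sum_sub_distrib]
            congr 1
            · rw [Finset.sum_comm]
              refine Finset.sum_congr rfl fun b _ => ?_
              rw [← Finset.sum_mul, hcol]
            · rw [hTdef, Finset.sum_mul]
              exact Finset.sum_congr rfl fun a _ => by rw [Finset.mul_sum]
        _ = 0 := by rw [← Finset.sum_div]; field_simp; ring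
    exact (mul_eq_zero.1 h1).resolve_left hμ.ne'
  set x : ι → ℝ := fun a => e a / √(r a) with hx
  have heig : ∀ a, (∑ b, A a b * x b) / √(r a) = μ * e a := by
    intro a
    rw [← he a, Finset.sum_div]
    have : ∑ b, √(r a) * √(r b) / T * e b = 0 := by
      have : ∑ b, √(r a) * √(r b) / T * e b = √(r a) / T * ∑ b, √(r b) * e b := by
        rw [Finset.mul_sum]; exact Finset.sum_congr rfl fun b _ => by ring
      rw [this, horth, mul_zero]
    simp only [sub_mul, Finset.sum_sub_distrib, this, sub_zero]
    exact Finset.sum_congr rfl fun b _ => by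
      simp only [hx, div_eq_mul_inv, mul_inv]; ring
  -- Where `r a = 0` the division defaults to `0`, and `heig` then forces `e a = 0`.
  have hex : ∀ a, e a = √(r a) * x a := by
    intro a
    by_cases h : √(r a) = 0
    · have := heig a
      rw [h, div_zero] at this
      have := (mul_eq_zero.1 this.symm).resolve_left hμ.ne'
      simp [this, h]
    · simp only [hx]; field_simp
  have hAx : ∀ a, ∑ b, A a b * x b = μ * (r a * x a) := by
    intro a
    by_cases h : r a = 0
    · simp [hrow a h, h]
    · have h' : √(r a) ≠ 0 := fun h2 => h (hs0 a h2)
      have := heig a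
      rw [div_eq_iff h', hex a] at this
      rw [this]; linear_combination μ * x a * hss a
  set Z := ∑ a, r a * x a ^ 2 with hZ
  have hZ0 : 0 ≤ Z := Finset.sum_nonneg fun a _ => mul_nonneg (hr0 a) (sq_nonneg _)
  have hfin : Z = 0 → e = 0 := by
    intro h
    have := (Finset.sum_eq_zero_iff_of_nonneg
      fun a _ => mul_nonneg (hr0 a) (sq_nonneg (x a))).1 h
    funext a
    have := this a (Finset.mem_univ _)
    rw [hex a]
    rcases mul_eq_zero.1 this with h | h
    · simp [h]
    · simp [pow_eq_zero_iff] at h; simp [h]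
  rcases hZ0.eq_or_lt with h | hZpos
  · exact hfin h.symm
  have hquad : ∑ a, x a * ∑ b, A a b * x b = μ * Z := by
    rw [hZ, Finset.mul_sum]
    exact Finset.sum_congr rfl fun a _ => by rw [hAx]; ring
  -- Substituting `A x = μ D x` into `A ≤ A D⁻¹ A` gives `μ ≤ μ²` when `Z > 0`.
  have hge : μ * Z ≤ μ ^ 2 * Z := by
    have h1 := hA x
    rw [hquad] at h1
    refine h1.trans_eq ?_
    rw [hZ, Finset.mul_sum]
    refine Finset.sum_congr rfl fun a _ => ?_
    rw [hAx]
    by_cases h : r a = 0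
    · simp [h]
    · field_simp
  have hμ1 : 1 ≤ μ := by
    by_contra! hlt
    nlinarith [mul_pos hμ hZpos, mul_pos (mul_pos hμ hZpos) (sub_pos.2 hlt)]
  -- The Dirichlet form is nonnegative, yet equals `2(1 - μ)Z ≤ 0`. So `x` is constant along the
  -- support of `A`, and orthogonality to `√r` makes that constant zero.
  have hdir : ∑ a, ∑ b, A a b * (x a - x b) ^ 2 = 2 * (1 - μ) * Z := by
    have h1 : ∑ a, ∑ b, A a b * x a ^ 2 = Z :=
      Finset.sum_congr rfl fun a _ => by rw [← Finset.sum_mul, ← hr]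
    have h2 : ∑ a, ∑ b, A a b * x b ^ 2 = Z := by
      rw [Finset.sum_comm, ← h1]
      exact Finset.sum_congr rfl fun a _ => Finset.sum_congr rfl fun b _ => by rw [hsy]
    have h3 : ∑ a, ∑ b, x a * (A a b * x b) = μ * Z := by
      rw [← hquad]; exact Finset.sum_congr rfl fun a _ => by rw [Finset.mul_sum]
    have : ∀ a b, A a b * (x a - x b) ^ 2 =
        A a b * x a ^ 2 + A a b * x b ^ 2 - 2 * (x a * (A a b * x b)) := fun a b => by ring
    simp only [this, Finset.sum_sub_distrib, Finset.sum_add_distrib, ← Finset.mul_sum, h1, h2]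
    simp only [← Finset.mul_sum] at h3
    rw [h3]; ring
  have hnn : ∀ a b, 0 ≤ A a b * (x a - x b) ^ 2 := fun a b => mul_nonneg (h0 a b) (sq_nonneg _)
  have hd0 : ∑ a, ∑ b, A a b * (x a - x b) ^ 2 = 0 := by
    refine le_antisymm ?_ (Finset.sum_nonneg fun a _ => Finset.sum_nonneg fun b _ => hnn a b)
    rw [hdir]; nlinarith
  have hloc : ∀ a b, A a b ≠ 0 → x a = x b := by
    intro a b hab
    have h1 := (Finset.sum_eq_zero_iff_of_nonneg
      fun a _ => Finset.sum_nonneg fun b _ => hnn a b).1 hd0 a (Finset.mem_univ _)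
    have h2 := (Finset.sum_eq_zero_iff_of_nonneg fun b _ => hnn a b).1 h1 b (Finset.mem_univ _)
    have h3 := (mul_eq_zero.1 h2).resolve_left hab
    exact sub_eq_zero.1 (pow_eq_zero_iff (two_ne_zero)|>.1 h3)
  have hconst := hconn x hloc
  obtain ⟨a₀, -, ha₀⟩ := Finset.exists_ne_zero_of_sum_ne_zero hT
  have hrx : ∑ a, r a * x a = T * x a₀ := by
    rw [hTdef, Finset.sum_mul]
    refine Finset.sum_congr rfl fun a _ => ?_
    by_cases h : r a = 0
    · simp [h]
    · rw [hconst a a₀ h ha₀]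
  have hx0 : x a₀ = 0 := by
    have : ∑ a, r a * x a = 0 := by
      rw [← horth]
      exact Finset.sum_congr rfl fun a _ => by
        rw [hex a]; linear_combination -(x a) * hss a
    exact (mul_eq_zero.1 (hrx.symm.trans this)).resolve_left hT
  apply hfin
  refine Finset.sum_eq_zero fun a _ => ?_
  by_cases h : r a = 0
  · simp [h]
  · rw [hconst a a₀ h ha₀, hx0]; simp

/-- Let `A` be a nonnegative symmetric matrix with row sums `r` and `A ≤ A D⁻¹ A`,
`D = diag r`, whose support is connected. Then `A` is nonpositive on vectors `D`-orthogonal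
to the all-ones vector. -/
theorem quadForm_nonpos_of_le {ι : Type*} [Fintype ι] (A : Matrix ι ι ℝ)
    (hsym : A.IsSymm) (h0 : ∀ a b, 0 ≤ A a b) (r : ι → ℝ) (hr : ∀ a, r a = ∑ b, A a b)
    (hA : ∀ x : ι → ℝ, ∑ a, x a * ∑ b, A a b * x b ≤ ∑ c, (∑ b, A c b * x b) ^ 2 / r c)
    (hconn : ∀ f : ι → ℝ, (∀ a b, A a b ≠ 0 → f a = f b) →
      ∀ a b, r a ≠ 0 → r b ≠ 0 → f a = f b)
    (x : ι → ℝ) (hx : ∑ a, r a * x a = 0) :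
    ∑ a, x a * ∑ b, A a b * x b ≤ 0 := by
  classical
  have hr0 : ∀ a, 0 ≤ r a := fun a => hr a ▸ Finset.sum_nonneg fun b _ => h0 a b
  have hrow : ∀ a, r a = 0 → ∀ b, A a b = 0 := fun a ha b =>
    (Finset.sum_eq_zero_iff_of_nonneg fun b _ => h0 a b).1 ((hr a).symm.trans ha) b
      (Finset.mem_univ _)
  have hsy : ∀ a b, A a b = A b a := fun a b => by rw [← hsym.apply]
  have hss : ∀ a, √(r a) * √(r a) = r a := fun a => Real.mul_self_sqrt (hr0 a)
  have hs0 : ∀ a, √(r a) = 0 → r a = 0 := fun a h => (Real.sqrt_eq_zero (hr0 a)).1 h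
  by_cases hT : ∑ a, r a = 0
  · have h1 := (Finset.sum_eq_zero_iff_of_nonneg fun a _ => hr0 a).1 hT
    refine (Finset.sum_eq_zero fun a _ => ?_).le
    simp [hrow a (h1 a (Finset.mem_univ _))]
  set M : Matrix ι ι ℝ := Matrix.of fun a b =>
    -(A a b / (√(r a) * √(r b)) - √(r a) * √(r b) / ∑ a, r a) with hM
  have hherm : M.IsHermitian := by
    ext a b
    simp only [hM, Matrix.conjTranspose_apply, Matrix.of_apply, star_trivial]
    rw [hsy a b, mul_comm √(r a)]
  have hpsd : M.PosSemidef := by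
    rw [hherm.posSemidef_iff_eigenvalues_nonneg]
    intro i
    by_contra! hlt
    have hmul := hherm.mulVec_eigenvectorBasis i
    have hz := eq_zero_of_deflated_eigenvector A hsym h0 r hr hA hconn hT
      (⇑(hherm.eigenvectorBasis i)) (-hherm.eigenvalues i) (neg_pos.2 hlt) (by
        intro a
        have := congrFun hmul a
        simp only [Matrix.mulVec, dotProduct, hM, Matrix.of_apply, Pi.smul_apply,
          smul_eq_mul, neg_mul, Finset.sum_neg_distrib] at this
        rw [neg_mul, ← this, neg_neg])
    have hn := hherm.eigenvectorBasis.orthonormal.1 i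
    have : hherm.eigenvectorBasis i = 0 := by ext a; exact congrFun hz a
    rw [this] at hn
    simp at hn
  -- At the vector `√r · x` the deflation term vanishes by `hx`, leaving minus the quadratic form of
  -- `A`.
  have key := hpsd.dotProduct_mulVec_nonneg (fun a => √(r a) * x a)
  have hval : (star fun a => √(r a) * x a) ⬝ᵥ M *ᵥ (fun a => √(r a) * x a) =
      -(∑ a, x a * ∑ b, A a b * x b) := by
    have h2 : ∀ a, (M *ᵥ fun a => √(r a) * x a) a = -((∑ b, A a b * x b) / √(r a)) := by
      intro a
      have h3 : ∀ b, M a b * (√(r b) * x b) =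
          -(A a b * x b / √(r a)) + √(r a) / (∑ a, r a) * (r b * x b) := by
        intro b
        simp only [hM, Matrix.of_apply]
        by_cases h : √(r b) = 0
        · rw [hsy a b, hrow b (hs0 b h), hs0 b h]; simp
        · rw [show r b * x b = √(r b) * √(r b) * x b by rw [hss]]
          generalize hg : √(r b) = s at *
          rw [div_mul_eq_div_div]
          field_simp
          ring
      simp only [Matrix.mulVec, dotProduct, h3, Finset.sum_add_distrib, ← Finset.mul_sum, hx,
        mul_zero, add_zero, Finset.sum_neg_distrib, ← Finset.sum_div]
    simp only [dotProduct, h2, ← Finset.sum_neg_distrib]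
    refine Finset.sum_congr rfl fun a _ => ?_
    simp only [Pi.star_apply, star_trivial]
    by_cases h : √(r a) = 0
    · simp [hrow a (hs0 a h)]
    · field_simp
  rw [hval] at key
  linarith

/-! ### Counting independent extensions in a binary matroid and its contractions. -/

section Extension

variable {ι E : Type*} [Fintype ι] [AddCommGroup E] [Module (ZMod 2) E]

/-- The subspace generated by `V` and `x`. -/
abbrev adjoinVec (V : Submodule (ZMod 2) E) (x : E) : Submodule (ZMod 2) E :=
  V ⊔ Submodule.span (ZMod 2) {x}

theorem adjoinVec_comm (V : Submodule (ZMod 2) E) (x y : E) :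
    adjoinVec (adjoinVec V x) y = adjoinVec (adjoinVec V y) x :=
  sup_right_comm _ _ _

theorem adjoinVec_of_mem {V : Submodule (ZMod 2) E} {x : E} (h : x ∈ V) : adjoinVec V x = V :=
  sup_eq_left.2 ((Submodule.span_singleton_le_iff_mem _ _).2 h)

theorem mem_adjoinVec_iff {V : Submodule (ZMod 2) E} {x y : E} :
    y ∈ adjoinVec V x ↔ y ∈ V ∨ y - x ∈ V := by
  rw [Submodule.mem_sup]
  constructor
  · rintro ⟨u, hu, w, hw, rfl⟩
    obtain ⟨c, rfl⟩ := Submodule.mem_span_singleton.1 hw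
    fin_cases c
    · left
      change u + (0 : ZMod 2) • x ∈ V
      simpa using hu
    · right
      change u + (1 : ZMod 2) • x - x ∈ V
      simpa using hu
  · rintro (h | h)
    · exact ⟨y, h, 0, Submodule.zero_mem _, add_zero _⟩
    · exact ⟨y - x, h, x, Submodule.mem_span_singleton_self _, sub_add_cancel _ _⟩

theorem adjoinVec_sup_span_range {κ : Type*} (v : κ → E) (V : Submodule (ZMod 2) E)
    (a : κ) : adjoinVec V (v a) ⊔ Submodule.span (ZMod 2) (Set.range v) =
      V ⊔ Submodule.span (ZMod 2) (Set.range v) := by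
  have h : Submodule.span (ZMod 2) {v a} ≤ Submodule.span (ZMod 2) (Set.range v) :=
    Submodule.span_mono (Set.singleton_subset_iff.2 (Set.mem_range_self a))
  rw [adjoinVec, sup_assoc, sup_eq_right.2 h]

theorem sup_span_range_cons {m : ℕ} (V : Submodule (ZMod 2) E) (x : E) (c : Fin m → E) :
    V ⊔ Submodule.span (ZMod 2) (Set.range (Fin.cons x c : Fin (m + 1) → E)) =
      adjoinVec V x ⊔ Submodule.span (ZMod 2) (Set.range c) := by
  rw [Fin.range_cons, Submodule.span_insert, sup_assoc]

/-- The family `c` is linearly independent modulo `V`. -/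
def IndepMod {m : ℕ} (V : Submodule (ZMod 2) E) (c : Fin m → E) : Prop :=
  Module.finrank (ZMod 2) ↥(V ⊔ Submodule.span (ZMod 2) (Set.range c)) =
    Module.finrank (ZMod 2) V + m

open Classical in
/-- The number of `m`-tuples of elements of the family `v` independent modulo `V`. -/
noncomputable def extCount (v : ι → E) (m : ℕ) (V : Submodule (ZMod 2) E) : ℝ :=
  ∑ c : Fin m → ι, if IndepMod V (v ∘ c) then 1 else 0

open Classical in
/-- The number of `m`-tuples which extend `(v a, v b)` to a tuple independent modulo `V`. -/
noncomputable def pairCount (v : ι → E) (m : ℕ) (V : Submodule (ZMod 2) E) : Matrix ι ι ℝ :=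
  Matrix.of fun a b =>
    if Module.finrank (ZMod 2) (adjoinVec (adjoinVec V (v a)) (v b)) =
        Module.finrank (ZMod 2) V + 2 then
      extCount v m (adjoinVec (adjoinVec V (v a)) (v b)) else 0

theorem extCount_nonneg (v : ι → E) (m : ℕ) (V : Submodule (ZMod 2) E) : 0 ≤ extCount v m V :=
  Finset.sum_nonneg fun _ _ => by split_ifs <;> norm_num

theorem pairCount_nonneg (v : ι → E) (m : ℕ) (V : Submodule (ZMod 2) E) (a b : ι) :
    0 ≤ pairCount v m V a b := by
  simp only [pairCount, Matrix.of_apply]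
  split_ifs
  exacts [extCount_nonneg _ _ _, le_rfl]

theorem pairCount_comm (v : ι → E) (m : ℕ) (V : Submodule (ZMod 2) E) (a b : ι) :
    pairCount v m V a b = pairCount v m V b a := by
  simp only [pairCount, Matrix.of_apply]
  rw [adjoinVec_comm V (v a) (v b)]

theorem extCount_zero (v : ι → E) (V : Submodule (ZMod 2) E) : extCount v 0 V = 1 := by
  have : ∀ c : Fin 0 → ι, IndepMod V (v ∘ c) := fun c => by
    rw [IndepMod, Set.range_eq_empty, Submodule.span_empty, sup_bot_eq, add_zero]
  simp [extCount, this]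

theorem sum_mul_ite_eq_nonneg {κ : Type*} [DecidableEq κ] (y : ι → ℝ) (f : ι → κ) :
    0 ≤ ∑ a, ∑ b, y a * y b * (if f a = f b then 1 else 0) := by
  classical
  have h : ∀ a b, y a * y b * (if f a = f b then (1 : ℝ) else 0) =
      ∑ c ∈ Finset.univ.image f, (if f a = c then y a else 0) * (if f b = c then y b else 0) := by
    intro a b
    rw [Finset.sum_eq_single_of_mem (f a) (Finset.mem_image_of_mem _ (Finset.mem_univ _))]
    · simp only [if_true, eq_comm (a := f b)]; split_ifs <;> ring
    · intro c _ hc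
      rw [if_neg (Ne.symm hc), zero_mul]
  simp only [h]
  rw [Finset.sum_congr rfl fun a _ => Finset.sum_comm, Finset.sum_comm]
  refine Finset.sum_nonneg fun c _ => ?_
  rw [← Finset.sum_mul_sum]
  exact mul_self_nonneg _

variable [Finite E]

theorem finrank_adjoinVec_of_notMem {V : Submodule (ZMod 2) E} {x : E} (h : x ∉ V) :
    Module.finrank (ZMod 2) (adjoinVec V x) = Module.finrank (ZMod 2) V + 1 :=
  Submodule.finrank_sup_span_singleton h

theorem finrank_adjoinVec_le (V : Submodule (ZMod 2) E) (x : E) :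
    Module.finrank (ZMod 2) (adjoinVec V x) ≤ Module.finrank (ZMod 2) V + 1 := by
  by_cases h : x ∈ V
  · rw [adjoinVec_of_mem h]; omega
  · exact (finrank_adjoinVec_of_notMem h).le

theorem finrank_adjoinVec_eq_iff {V : Submodule (ZMod 2) E} {x : E} :
    Module.finrank (ZMod 2) (adjoinVec V x) = Module.finrank (ZMod 2) V + 1 ↔ x ∉ V := by
  refine ⟨fun h hx => ?_, finrank_adjoinVec_of_notMem⟩
  rw [adjoinVec_of_mem hx] at h
  omega

theorem finrank_sup_span_range_le {m : ℕ} (V : Submodule (ZMod 2) E) (c : Fin m → E) :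
    Module.finrank (ZMod 2) ↥(V ⊔ Submodule.span (ZMod 2) (Set.range c)) ≤
      Module.finrank (ZMod 2) V + m := by
  refine (Submodule.finrank_add_le_finrank_add_finrank _ _).trans ?_
  have := finrank_range_le_card (R := ZMod 2) c
  rw [Set.finrank, Fintype.card_fin] at this
  omega

theorem indepMod_cons {m : ℕ} {V : Submodule (ZMod 2) E} {x : E} {c : Fin m → E} :
    IndepMod V (Fin.cons x c : Fin (m + 1) → E) ↔ x ∉ V ∧ IndepMod (adjoinVec V x) c := by
  rw [IndepMod, IndepMod, sup_span_range_cons, ← finrank_adjoinVec_eq_iff]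
  have := finrank_adjoinVec_le V x
  have := finrank_sup_span_range_le (adjoinVec V x) c
  omega

open Classical in
theorem extCount_succ (v : ι → E) (m : ℕ) (V : Submodule (ZMod 2) E) :
    extCount v (m + 1) V = ∑ c, if v c ∈ V then 0 else extCount v m (adjoinVec V (v c)) := by
  rw [extCount, ← (Fin.consEquiv fun _ : Fin (m + 1) => ι).sum_comp, Fintype.sum_prod_type]
  refine Finset.sum_congr rfl fun c _ => ?_
  have h : ∀ d : Fin m → ι, v ∘ (Fin.cons c d : Fin (m + 1) → ι) = Fin.cons (v c) (v ∘ d) :=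
    fun d => by ext i; refine Fin.cases ?_ (fun j => ?_) i <;> simp
  simp only [Fin.consEquiv, Equiv.coe_fn_mk, h, indepMod_cons]
  split_ifs with hc
  · simp [hc]
  · simp [hc, extCount]

-- Splits off the first of the remaining vectors and contracts by it: independence of a tuple does
-- not depend on the order in which its vectors are adjoined.
open Classical in
theorem pairCount_succ (v : ι → E) (m : ℕ) (V : Submodule (ZMod 2) E) (a b : ι) :
    pairCount v (m + 1) V a b =
      ∑ c, if v c ∈ V then 0 else pairCount v m (adjoinVec V (v c)) a b := by
  simp only [pairCount, Matrix.of_apply]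
  split_ifs with h
  · rw [extCount_succ]
    refine Finset.sum_congr rfl fun c _ => ?_
    have e1 : adjoinVec (adjoinVec (adjoinVec V (v a)) (v b)) (v c) =
        adjoinVec (adjoinVec (adjoinVec V (v c)) (v a)) (v b) := by
      rw [adjoinVec_comm (adjoinVec V (v a)), adjoinVec_comm V (v a) (v c)]
    by_cases h1 : v c ∈ V
    · have : v c ∈ adjoinVec (adjoinVec V (v a)) (v b) :=
        Submodule.mem_sup_left (Submodule.mem_sup_left h1)
      simp [h1, this]
    · rw [if_neg h1, ← e1, finrank_adjoinVec_of_notMem h1]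
      by_cases h2 : v c ∈ adjoinVec (adjoinVec V (v a)) (v b)
      · rw [if_pos h2, if_neg]
        rw [adjoinVec_of_mem h2]; omega
      · rw [if_neg h2, if_pos]
        rw [finrank_adjoinVec_of_notMem h2]; omega
  · symm
    refine Finset.sum_eq_zero fun c _ => ?_
    by_cases h1 : v c ∈ V
    · rw [if_pos h1]
    · rw [if_neg h1, if_neg]
      intro h2
      rw [adjoinVec_comm V, adjoinVec_comm _ (v c)] at h2
      have h3 := finrank_adjoinVec_of_notMem h1
      have h4 := finrank_adjoinVec_le (adjoinVec (adjoinVec V (v a)) (v b)) (v c)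
      have h5 := finrank_adjoinVec_le V (v a)
      have h6 := finrank_adjoinVec_le (adjoinVec V (v a)) (v b)
      omega

-- Both sides count the independent tuples beginning with `c, a`; on the left the next vector `b` is
-- summed out. This identifies the row sums of a contraction with a row of the larger matrix.
open Classical in
theorem sum_pairCount_adjoin (v : ι → E) (m : ℕ) (V : Submodule (ZMod 2) E) (c a : ι) :
    (∑ b, if v c ∈ V then 0 else pairCount v m (adjoinVec V (v c)) a b) =
      pairCount v (m + 1) V c a := by
  by_cases h : v c ∈ V
  · simp only [h, if_true, Finset.sum_const_zero, pairCount, Matrix.of_apply]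
    rw [if_neg]
    rw [adjoinVec_of_mem h]
    have := finrank_adjoinVec_le V (v a)
    omega
  · simp only [h, if_false, pairCount, Matrix.of_apply, finrank_adjoinVec_of_notMem h]
    by_cases h2 : v a ∈ adjoinVec V (v c)
    · rw [if_neg (by rw [adjoinVec_of_mem h2, finrank_adjoinVec_of_notMem h]; omega)]
      refine Finset.sum_eq_zero fun b _ => if_neg ?_
      rw [adjoinVec_of_mem h2]
      have := finrank_adjoinVec_le (adjoinVec V (v c)) (v b)
      have := finrank_adjoinVec_of_notMem h
      omega
    · have h3 := finrank_adjoinVec_of_notMem h2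
      have h4 := finrank_adjoinVec_of_notMem h
      rw [if_pos (by omega), extCount_succ]
      refine Finset.sum_congr rfl fun b _ => ?_
      by_cases h5 : v b ∈ adjoinVec (adjoinVec V (v c)) (v a)
      · rw [if_pos h5, if_neg]
        rw [adjoinVec_of_mem h5]; omega
      · rw [if_neg h5, if_pos]
        rw [finrank_adjoinVec_of_notMem h5]; omega

theorem extCount_pos (v : ι → E) (m : ℕ) (V : Submodule (ZMod 2) E)
    (h : Module.finrank (ZMod 2) V + m ≤
      Module.finrank (ZMod 2) ↥(V ⊔ Submodule.span (ZMod 2) (Set.range v))) :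
    0 < extCount v m V := by
  classical
  induction m generalizing V with
  | zero => rw [extCount_zero]; exact one_pos
  | succ m ih =>
    have hex : ∃ c, v c ∉ V := by
      by_contra! hall
      have : Submodule.span (ZMod 2) (Set.range v) ≤ V := by
        rw [Submodule.span_le]; rintro _ ⟨c, rfl⟩; exact hall c
      rw [sup_eq_left.2 this] at h
      omega
    obtain ⟨c, hc⟩ := hex
    rw [extCount_succ]
    refine Finset.sum_pos' (fun c _ => ?_) ⟨c, Finset.mem_univ _, ?_⟩
    · split_ifs
      exacts [le_rfl, extCount_nonneg _ _ _]
    · rw [if_neg hc]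
      apply ih
      rw [adjoinVec_sup_span_range, finrank_adjoinVec_of_notMem hc]
      omega

theorem finrank_of_extCount_ne_zero (v : ι → E) (m : ℕ) (V : Submodule (ZMod 2) E)
    (h : extCount v m V ≠ 0) : Module.finrank (ZMod 2) V + m ≤
      Module.finrank (ZMod 2) ↥(V ⊔ Submodule.span (ZMod 2) (Set.range v)) := by
  obtain ⟨c, -, hc⟩ := Finset.exists_ne_zero_of_sum_ne_zero h
  have hc' : IndepMod V (v ∘ c) := by by_contra h'; simp [h'] at hc
  rw [← hc']
  exact Submodule.finrank_mono
    (sup_le_sup_left (Submodule.span_mono (Set.range_comp_subset_range _ _)) _)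

theorem pairCount_pos (v : ι → E) (m : ℕ) (V : Submodule (ZMod 2) E) {a b : ι} (ha : v a ∉ V)
    (hb : v b ∉ adjoinVec V (v a)) (h : Module.finrank (ZMod 2) V + m + 2 ≤
      Module.finrank (ZMod 2) ↥(V ⊔ Submodule.span (ZMod 2) (Set.range v))) :
    pairCount v m V a b ≠ 0 := by
  simp only [pairCount, Matrix.of_apply]
  have h1 := finrank_adjoinVec_of_notMem ha
  have h2 := finrank_adjoinVec_of_notMem hb
  rw [if_pos (by omega)]
  refine (extCount_pos _ _ _ ?_).ne'
  rw [adjoinVec_sup_span_range, adjoinVec_sup_span_range]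
  omega

theorem of_pairCount_ne_zero {v : ι → E} {m : ℕ} {V : Submodule (ZMod 2) E} {a b : ι}
    (h : pairCount v m V a b ≠ 0) : v a ∉ V ∧ v b ∉ adjoinVec V (v a) ∧
      Module.finrank (ZMod 2) V + m + 2 ≤
      Module.finrank (ZMod 2) ↥(V ⊔ Submodule.span (ZMod 2) (Set.range v)) := by
  simp only [pairCount, Matrix.of_apply] at h
  split_ifs at h with h1
  · have h2 := finrank_adjoinVec_le V (v a)
    have h3 := finrank_adjoinVec_le (adjoinVec V (v a)) (v b)
    have h4 := finrank_of_extCount_ne_zero _ _ _ h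
    rw [adjoinVec_sup_span_range, adjoinVec_sup_span_range] at h4
    refine ⟨finrank_adjoinVec_eq_iff.1 (by omega), finrank_adjoinVec_eq_iff.1 (by omega), by omega⟩
  · exact absurd rfl h

/-- Two non-loops that are not parallel modulo `V` are adjacent, as any independent pair extends
greedily when the rank allows. Parallel ones span the same space with `V` and so share their
neighbours. -/
theorem pairCount_connected (v : ι → E) (m : ℕ) (V : Submodule (ZMod 2) E) (f : ι → ℝ)
    (hf : ∀ a b, pairCount v m V a b ≠ 0 → f a = f b) (a b : ι)
    (ha : ∑ b, pairCount v m V a b ≠ 0) (hb : ∑ c, pairCount v m V b c ≠ 0) : f a = f b := by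
  obtain ⟨c, -, hc⟩ := Finset.exists_ne_zero_of_sum_ne_zero ha
  obtain ⟨d, -, hd⟩ := Finset.exists_ne_zero_of_sum_ne_zero hb
  obtain ⟨h1, h2, h3⟩ := of_pairCount_ne_zero hc
  obtain ⟨h4, h5, -⟩ := of_pairCount_ne_zero hd
  by_cases hab : v b ∈ adjoinVec V (v a)
  · have hle : adjoinVec V (v b) ≤ adjoinVec V (v a) :=
      sup_le le_sup_left ((Submodule.span_singleton_le_iff_mem _ _).2 hab)
    rw [hf a c hc, hf b c (pairCount_pos v m V h4 (fun h => h2 (hle h)) h3)]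
  · exact hf a b (pairCount_pos v m V h1 hab h3)

-- In rank two the matrix is the adjacency matrix of a complete multipartite graph on the non-loops,
-- whose classes are the cosets of `V`.
open Classical in
theorem pairCount_zero_apply (v : ι → E) (V : Submodule (ZMod 2) E) (a b : ι) :
    pairCount v 0 V a b = (if v a ∈ V then 0 else 1) * (if v b ∈ V then 0 else 1) *
      (1 - if V.mkQ (v a) = V.mkQ (v b) then 1 else 0) := by
  have key : Module.finrank (ZMod 2) (adjoinVec (adjoinVec V (v a)) (v b)) =
        Module.finrank (ZMod 2) V + 2 ↔ v a ∉ V ∧ v b ∉ V ∧ ¬ V.mkQ (v a) = V.mkQ (v b) := by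
    have h2 := finrank_adjoinVec_le V (v a)
    have h3 := finrank_adjoinVec_le (adjoinVec V (v a)) (v b)
    have : Module.finrank (ZMod 2) (adjoinVec (adjoinVec V (v a)) (v b)) =
        Module.finrank (ZMod 2) V + 2 ↔ v a ∉ V ∧ v b ∉ adjoinVec V (v a) := by
      rw [← finrank_adjoinVec_eq_iff, ← finrank_adjoinVec_eq_iff]; omega
    rw [this, mem_adjoinVec_iff, not_or, eq_comm, Submodule.mkQ_apply, Submodule.mkQ_apply,
      Submodule.Quotient.eq]
  simp only [pairCount, Matrix.of_apply, key, extCount_zero]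
  by_cases h1 : v a ∈ V
  · simp [h1]
  by_cases h2 : v b ∈ V
  · simp [h2]
  by_cases h3 : V.mkQ (v a) = V.mkQ (v b)
  · simp [h3]
  · simp only [h1, h2, h3]; simp

/-- The numbers of extensions of pairs to independent tuples satisfy the reverse
Cauchy–Schwarz inequality against the all-ones vector. -/
theorem pairCount_reverse_cauchySchwarz (v : ι → E) (m : ℕ) (V : Submodule (ZMod 2) E)
    (x : ι → ℝ) : (x ⬝ᵥ pairCount v m V *ᵥ x) * (1 ⬝ᵥ pairCount v m V *ᵥ 1) ≤
      (x ⬝ᵥ pairCount v m V *ᵥ 1) ^ 2 := by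
  classical
  have hsym : ∀ m V, (pairCount v m V).IsSymm := fun m V => by
    ext a b; exact pairCount_comm v m V b a
  have hone : ∀ m V, 0 ≤ (1 : ι → ℝ) ⬝ᵥ pairCount v m V *ᵥ 1 := fun m V => by
    refine Finset.sum_nonneg fun a _ => ?_
    simp only [Pi.one_apply, one_mul, mulVec, dotProduct, mul_one]
    exact Finset.sum_nonneg fun b _ => pairCount_nonneg _ _ _ _ _
  induction m generalizing V x with
  | zero =>
    set l : ι → ℝ := fun a => if v a ∈ V then 0 else 1 with hl
    -- The form is the square of the linear form `l`, minus a sum of squares over the cosets of `V`.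
    have hquad : ∀ z : ι → ℝ, ∑ a, l a * z a = 0 → z ⬝ᵥ pairCount v 0 V *ᵥ z ≤ 0 := by
      intro z hz
      have h1 := sum_mul_ite_eq_nonneg (fun a => l a * z a) fun a => V.mkQ (v a)
      have h2 : z ⬝ᵥ pairCount v 0 V *ᵥ z = (∑ a, l a * z a) * (∑ a, l a * z a) -
          ∑ a, ∑ b, l a * z a * (l b * z b) * (if V.mkQ (v a) = V.mkQ (v b) then 1 else 0) := by
        rw [Finset.sum_mul_sum, ← Finset.sum_sub_distrib]
        refine Finset.sum_congr rfl fun a _ => ?_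
        rw [mulVec, dotProduct, Finset.mul_sum, ← Finset.sum_sub_distrib]
        refine Finset.sum_congr rfl fun b _ => ?_
        rw [pairCount_zero_apply]
        simp only [hl]
        ring
      rw [h2, hz]
      linarith
    by_cases h0 : ∑ a, l a = 0
    · have hl0 : ∀ a, l a = 0 := fun a => (Finset.sum_eq_zero_iff_of_nonneg fun a _ => by
        simp only [hl]; split_ifs <;> norm_num).1 h0 a (Finset.mem_univ _)
      refine reverse_cauchySchwarz_one _ (hsym 0 V) (hone 0 V) x 0 (hquad _ ?_)
      simp [hl0]
    -- The shift is the mean of `x` weighted by `l`, so the translate is orthogonal to `l`.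
    · refine reverse_cauchySchwarz_one _ (hsym 0 V) (hone 0 V) x
        ((∑ a, l a * x a) / ∑ a, l a) (hquad _ ?_)
      simp only [Pi.sub_apply, Pi.smul_apply, Pi.one_apply, smul_eq_mul, mul_one, mul_sub,
        Finset.sum_sub_distrib, ← Finset.sum_mul]
      field_simp
      ring
  | succ m ih =>
    set A := pairCount v (m + 1) V with hA
    set C : ι → Matrix ι ι ℝ := fun c => if v c ∈ V then 0 else pairCount v m (adjoinVec V (v c))
      with hC
    have hCapp : ∀ c a b, C c a b =
        if v c ∈ V then 0 else pairCount v m (adjoinVec V (v c)) a b := fun c a b => by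
      simp only [hC]; split_ifs <;> rfl
    have hsum : ∀ x : ι → ℝ, x ⬝ᵥ A *ᵥ x = ∑ c, x ⬝ᵥ C c *ᵥ x := by
      intro x
      have : A = ∑ c, C c := by
        ext a b
        rw [Matrix.sum_apply, hA, pairCount_succ]
        exact Finset.sum_congr rfl fun c _ => (hCapp c a b).symm
      rw [this, Matrix.sum_mulVec, dotProduct_sum]
    have hCone : ∀ c, C c *ᵥ 1 = A c := by
      intro c
      ext a
      rw [hA, ← sum_pairCount_adjoin]
      simp [mulVec, dotProduct, hCapp]
    have hCih : ∀ c (x : ι → ℝ), (x ⬝ᵥ C c *ᵥ x) * (1 ⬝ᵥ C c *ᵥ 1) ≤ (x ⬝ᵥ C c *ᵥ 1) ^ 2 := by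
      intro c x
      simp only [hC]
      split_ifs
      · simp
      · exact ih _ _
    have hCnn : ∀ c a b, 0 ≤ C c a b := fun c a b => by
      rw [hCapp]; split_ifs
      exacts [le_rfl, pairCount_nonneg _ _ _ _ _]
    -- This is `A ≤ A D⁻¹ A`: sum the induction hypothesis over all contractions, divided by
    -- `1ᵀC_c1`, which is the row sum `r c`. If `r c = 0`, the nonnegative matrix `C c` vanishes,
    -- matching the default `_ / 0 = 0`.
    have hdom : ∀ x : ι → ℝ, ∑ a, x a * ∑ b, A a b * x b ≤
        ∑ c, (∑ b, A c b * x b) ^ 2 / ∑ b, A c b := by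
      intro x
      have h1 := hsum x
      simp only [mulVec, dotProduct] at h1
      rw [h1]
      refine Finset.sum_le_sum fun c _ => ?_
      have h2 := hCih c x
      have h3 : (1 : ι → ℝ) ⬝ᵥ C c *ᵥ 1 = ∑ b, A c b := by
        rw [hCone, one_dotProduct]
      have h4 : x ⬝ᵥ C c *ᵥ 1 = ∑ b, A c b * x b := by
        rw [hCone, dotProduct_comm]; rfl
      rw [h3, h4] at h2
      have h5 : 0 ≤ ∑ b, A c b := Finset.sum_nonneg fun b _ => pairCount_nonneg _ _ _ _ _
      rcases h5.eq_or_lt with h6 | h6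
      · rw [← h6, div_zero]
        have h7 : ∑ a, ∑ b, C c a b = 0 := by
          rw [h6, ← h3]; simp [mulVec, dotProduct]
        have h8 : ∀ a b, C c a b = 0 := fun a b =>
          (Finset.sum_eq_zero_iff_of_nonneg fun b _ => hCnn c a b).1
            ((Finset.sum_eq_zero_iff_of_nonneg fun a _ =>
              Finset.sum_nonneg fun b _ => hCnn c a b).1 h7 a (Finset.mem_univ _)) b
            (Finset.mem_univ _)
        simp [h8]
      · rw [le_div_iff₀ h6]
        exact h2
    have hneg := quadForm_nonpos_of_le A (hsym _ _) (fun a b => pairCount_nonneg _ _ _ _ _)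
      (fun a => ∑ b, A a b) (fun _ => rfl) hdom
      (fun f hf a b ha hb => pairCount_connected v (m + 1) V f hf a b ha hb)
    have hone' : (1 : ι → ℝ) ⬝ᵥ A *ᵥ 1 = ∑ a, ∑ b, A a b := by simp [mulVec, dotProduct]
    have hA0 : ∑ a, ∑ b, A a b = 0 → ∀ a, ∑ b, A a b = 0 := fun h a =>
      (Finset.sum_eq_zero_iff_of_nonneg fun a _ =>
        Finset.sum_nonneg fun b _ => pairCount_nonneg _ _ _ _ _).1 h a (Finset.mem_univ _)
    by_cases h0 : ∑ a, ∑ b, A a b = 0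
    · refine reverse_cauchySchwarz_one _ (hsym _ V) (hone _ V) x 0 (hneg _ ?_)
      simp [hA0 h0]
    · refine reverse_cauchySchwarz_one _ (hsym _ V) (hone _ V) x
        ((∑ a, (∑ b, A a b) * x a) / ∑ a, ∑ b, A a b) (hneg _ ?_)
      simp only [Pi.sub_apply, Pi.smul_apply, Pi.one_apply, smul_eq_mul, mul_one, mul_sub,
        Finset.sum_sub_distrib]
      rw [← Finset.sum_mul]
      field_simp
      ring

end Extension

/-! ### Symmetries of the ensemble and negative correlation of its rows. -/

section Ensemble

variable {n k t : ℕ}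

/-- The vector `a` if it has weight `t`, and `0` otherwise. -/
def weightVec (t : ℕ) (a : Fin n → ZMod 2) : Fin n → ZMod 2 :=
  if hammingNorm a = t then a else 0

theorem mem_ldgmEnsemble {G : Matrix (Fin k) (Fin n) (ZMod 2)} :
    G ∈ ldgmEnsemble n k t ↔
      (∀ i, hammingNorm (G i) = t) ∧ Module.finrank (ZMod 2) (rowCode G) = k := by
  simp [ldgmEnsemble]

theorem linearIndependent_of_mem_ldgmEnsemble {G : Matrix (Fin k) (Fin n) (ZMod 2)}
    (hG : G ∈ ldgmEnsemble n k t) : LinearIndependent (ZMod 2) fun i => G i := by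
  rw [linearIndependent_iff_card_eq_finrank_span, Set.finrank, Fintype.card_fin]
  exact (mem_ldgmEnsemble.1 hG).2.symm

/-- Replacing vectors of the wrong weight by `0`, which lies in no independent tuple, absorbs the
weight condition into linear independence. -/
theorem mem_ldgmEnsemble_iff_indepMod {G : Matrix (Fin k) (Fin n) (ZMod 2)} :
    G ∈ ldgmEnsemble n k t ↔ IndepMod ⊥ (fun i => weightVec t (G i)) := by
  have hbot : ∀ c : Fin k → Fin n → ZMod 2, IndepMod ⊥ c ↔
      Module.finrank (ZMod 2) (Submodule.span (ZMod 2) (Set.range c)) = k := fun c => by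
    rw [IndepMod, bot_sup_eq, finrank_bot, zero_add]
  rw [hbot, mem_ldgmEnsemble]
  constructor
  · rintro ⟨h1, h2⟩
    have : (fun i => weightVec t (G i)) = fun i => G i := by
      funext i; rw [weightVec, if_pos (h1 i)]
    rw [this]
    exact h2
  · intro h
    have hli : LinearIndependent (ZMod 2) fun i => weightVec t (G i) := by
      rw [linearIndependent_iff_card_eq_finrank_span, Set.finrank, Fintype.card_fin, h]
    have hw : ∀ i, hammingNorm (G i) = t := fun i => by
      by_contra hne
      exact hli.ne_zero i (by rw [weightVec, if_neg hne])
    have : (fun i => weightVec t (G i)) = fun i => G i := by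
      funext i; rw [weightVec, if_pos (hw i)]
    rw [this] at h
    exact ⟨hw, h⟩

open Classical in
theorem sum_ldgmEnsemble_first_two (m : ℕ) (x y : (Fin n → ZMod 2) → ℝ) :
    ∑ G ∈ ldgmEnsemble n (m + 2) t, x (G 0) * y (G 1) =
      x ⬝ᵥ pairCount (weightVec t) m ⊥ *ᵥ y := by
  have h1 : ∑ G ∈ ldgmEnsemble n (m + 2) t, x (G 0) * y (G 1) =
      ∑ G : Fin (m + 2) → Fin n → ZMod 2,
        if IndepMod ⊥ (fun i => weightVec t (G i)) then x (G 0) * y (G 1) else 0 := by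
    rw [← Finset.sum_filter]
    refine Finset.sum_congr ?_ fun _ _ => rfl
    ext G
    rw [mem_ldgmEnsemble_iff_indepMod]
    exact ⟨fun h => Finset.mem_filter.2 ⟨Finset.mem_univ _, h⟩,
      fun h => (Finset.mem_filter.1 h).2⟩
  rw [h1, ← (Fin.consEquiv fun _ : Fin (m + 2) => Fin n → ZMod 2).sum_comp,
    Fintype.sum_prod_type]
  refine Finset.sum_congr rfl fun a _ => ?_
  rw [← (Fin.consEquiv fun _ : Fin (m + 1) => Fin n → ZMod 2).sum_comp,
    Fintype.sum_prod_type, mulVec, dotProduct, Finset.mul_sum]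
  refine Finset.sum_congr rfl fun b _ => ?_
  have hc : ∀ c : Fin m → Fin n → ZMod 2,
      (fun i => weightVec t ((Fin.cons a (Fin.cons b c : Fin (m + 1) → Fin n → ZMod 2) :
        Fin (m + 2) → Fin n → ZMod 2) i)) =
      Fin.cons (weightVec t a) (Fin.cons (weightVec t b) (weightVec t ∘ c) :
        Fin (m + 1) → Fin n → ZMod 2) := fun c => by
    funext i
    refine Fin.cases rfl (fun i => ?_) i
    refine Fin.cases rfl (fun i => rfl) i
  simp only [Fin.consEquiv, Equiv.coe_fn_mk, hc, indepMod_cons]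
  have h2 := finrank_adjoinVec_le ⊥ (weightVec t a)
  have h3 := finrank_adjoinVec_le (adjoinVec ⊥ (weightVec t a)) (weightVec t b)
  have key : Module.finrank (ZMod 2) (adjoinVec (adjoinVec ⊥ (weightVec t a)) (weightVec t b)) =
      Module.finrank (ZMod 2) (⊥ : Submodule (ZMod 2) (Fin n → ZMod 2)) + 2 ↔
      weightVec t a ∉ (⊥ : Submodule (ZMod 2) (Fin n → ZMod 2)) ∧
        weightVec t b ∉ adjoinVec ⊥ (weightVec t a) := by
    rw [← finrank_adjoinVec_eq_iff, ← finrank_adjoinVec_eq_iff]; omega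
  simp only [pairCount, Matrix.of_apply, key, extCount, ← and_assoc]
  by_cases h : weightVec t a ∉ (⊥ : Submodule (ZMod 2) (Fin n → ZMod 2)) ∧
        weightVec t b ∉ adjoinVec ⊥ (weightVec t a)
  · simp only [h, true_and, not_false_eq_true, if_true, Finset.sum_mul, Finset.mul_sum]
    refine Finset.sum_congr rfl fun c _ => ?_
    split_ifs
    · simp
    · simp
  · rw [if_neg h]
    simp only [h, false_and, if_false, Finset.sum_const_zero, zero_mul, mul_zero]

theorem submatrix_mem_ldgmEnsemble {G : Matrix (Fin k) (Fin n) (ZMod 2)}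
    (hG : G ∈ ldgmEnsemble n k t) (τ : Equiv.Perm (Fin k)) (σ : Equiv.Perm (Fin n)) :
    G.submatrix τ σ ∈ ldgmEnsemble n k t := by
  rw [mem_ldgmEnsemble] at hG ⊢
  refine ⟨fun i => ?_, ?_⟩
  · rw [← hG.1 (τ i), hammingNorm, hammingNorm]
    refine Finset.card_equiv σ fun j => ?_
    rw [Finset.mem_filter_univ, Finset.mem_filter_univ, submatrix_apply]
  · have h1 : rowCode (G.submatrix τ σ) =
        (rowCode G).map (LinearEquiv.funCongrLeft (ZMod 2) (ZMod 2) σ).toLinearMap := by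
      rw [rowCode, rowCode, Submodule.map_span, ← Set.range_comp, ← τ.surjective.range_comp (fun i => _)]
      rfl
    rw [h1, LinearEquiv.finrank_map_eq, hG.2]

theorem sum_submatrix_ldgmEnsemble (F : Matrix (Fin k) (Fin n) (ZMod 2) → ℝ)
    (τ : Equiv.Perm (Fin k)) (σ : Equiv.Perm (Fin n)) :
    ∑ G ∈ ldgmEnsemble n k t, F (G.submatrix τ σ) = ∑ G ∈ ldgmEnsemble n k t, F G := by
  refine Finset.sum_bij' (fun G _ => G.submatrix τ σ) (fun G _ => G.submatrix τ.symm σ.symm)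
    (fun G hG => submatrix_mem_ldgmEnsemble hG _ _)
    (fun G hG => submatrix_mem_ldgmEnsemble hG _ _) ?_ ?_ fun _ _ => rfl
  all_goals
    intro G _
    ext i j
    simp

/-- The first row of a random matrix of the ensemble meets a given column with probability
`t / n`. -/
theorem sum_entry_ldgmEnsemble (m : ℕ) (j : Fin n) :
    (n : ℝ) * ∑ G ∈ ldgmEnsemble n (m + 2) t, (if G 0 j ≠ 0 then (1 : ℝ) else 0) =
      t * ((ldgmEnsemble n (m + 2) t).card : ℝ) := by
  have h1 : ∀ j', ∑ G ∈ ldgmEnsemble n (m + 2) t, (if G 0 j' ≠ 0 then (1 : ℝ) else 0) =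
      ∑ G ∈ ldgmEnsemble n (m + 2) t, (if G 0 j ≠ 0 then (1 : ℝ) else 0) := fun j' => by
    rw [← sum_submatrix_ldgmEnsemble (fun G => if G 0 j ≠ 0 then (1 : ℝ) else 0) (Equiv.refl _)
      (Equiv.swap j j')]
    refine Finset.sum_congr rfl fun G _ => ?_
    simp
  calc (n : ℝ) * ∑ G ∈ ldgmEnsemble n (m + 2) t, (if G 0 j ≠ 0 then (1 : ℝ) else 0)
      = ∑ j', ∑ G ∈ ldgmEnsemble n (m + 2) t, (if G 0 j' ≠ 0 then (1 : ℝ) else 0) := by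
        simp only [h1, Finset.sum_const, Finset.card_univ, Fintype.card_fin, nsmul_eq_mul]
    _ = ∑ G ∈ ldgmEnsemble n (m + 2) t, (t : ℝ) := by
        rw [Finset.sum_comm]
        refine Finset.sum_congr rfl fun G hG => ?_
        rw [← (mem_ldgmEnsemble.1 hG).1 0, hammingNorm, Finset.sum_boole]
    _ = _ := by rw [Finset.sum_const, nsmul_eq_mul, mul_comm]

theorem sum_first_rows_meet_le (m : ℕ) :
    (n : ℝ) * ∑ G ∈ ldgmEnsemble n (m + 2) t,
      (if ∃ j, G 0 j ≠ 0 ∧ G 1 j ≠ 0 then (1 : ℝ) else 0) ≤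
      (t : ℝ) ^ 2 * ((ldgmEnsemble n (m + 2) t).card : ℝ) := by
  set Γ := ldgmEnsemble n (m + 2) t with hΓ
  set T : ℝ := (Γ.card : ℝ) with hT
  rcases Nat.eq_zero_or_pos n with rfl | hn
  · simp only [Nat.cast_zero, zero_mul]; positivity
  have hn' : (0 : ℝ) < n := Nat.cast_pos.2 hn
  have hcol : ∀ j : Fin n, (n : ℝ) ^ 2 * ∑ G ∈ Γ, (if G 0 j ≠ 0 then (1 : ℝ) else 0) *
      (if G 1 j ≠ 0 then (1 : ℝ) else 0) ≤ (t : ℝ) ^ 2 * T := by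
    intro j
    rcases (Nat.cast_nonneg Γ.card : (0 : ℝ) ≤ Γ.card).eq_or_lt with h0 | hpos
    · have : Γ = ∅ := Finset.card_eq_zero.1 (by exact_mod_cast h0.symm)
      simp only [this, Finset.sum_empty, mul_zero]
      positivity
    -- At the indicator of `a j ≠ 0`, reverse Cauchy–Schwarz says that the two rows both hit column
    -- `j` with probability at most `(t / n)²`. A union bound over the `n` columns follows.
    · have hlor := pairCount_reverse_cauchySchwarz (weightVec (n := n) t) m ⊥
        (fun a => if a j ≠ 0 then (1 : ℝ) else 0)
      rw [← sum_ldgmEnsemble_first_two, ← sum_ldgmEnsemble_first_two,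
        ← sum_ldgmEnsemble_first_two] at hlor
      simp only [Pi.one_apply, mul_one, Finset.sum_const, nsmul_eq_mul] at hlor
      have hB := sum_entry_ldgmEnsemble (t := t) m j
      rw [← hΓ] at hlor hB
      have h2 : ((n : ℝ) ^ 2 * ∑ G ∈ Γ, (if G 0 j ≠ 0 then (1 : ℝ) else 0) *
          (if G 1 j ≠ 0 then (1 : ℝ) else 0)) * T ≤ ((t : ℝ) ^ 2 * T) * T := by
        calc _ = (n : ℝ) ^ 2 * ((∑ G ∈ Γ, (if G 0 j ≠ 0 then (1 : ℝ) else 0) *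
              (if G 1 j ≠ 0 then (1 : ℝ) else 0)) * T) := by ring
          _ ≤ (n : ℝ) ^ 2 * (∑ G ∈ Γ, (if G 0 j ≠ 0 then (1 : ℝ) else 0)) ^ 2 :=
              mul_le_mul_of_nonneg_left hlor (by positivity)
          _ = (n * ∑ G ∈ Γ, (if G 0 j ≠ 0 then (1 : ℝ) else 0)) ^ 2 := by ring
          _ = _ := by rw [hB]; ring
      exact le_of_mul_le_mul_right h2 hpos
  have hle : ∑ G ∈ Γ, (if ∃ j, G 0 j ≠ 0 ∧ G 1 j ≠ 0 then (1 : ℝ) else 0) ≤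
      ∑ j : Fin n, ∑ G ∈ Γ, (if G 0 j ≠ 0 then (1 : ℝ) else 0) *
        (if G 1 j ≠ 0 then (1 : ℝ) else 0) := by
    rw [Finset.sum_comm]
    refine Finset.sum_le_sum fun G _ => ?_
    have hnn : ∀ j : Fin n, 0 ≤ (if G 0 j ≠ 0 then (1 : ℝ) else 0) *
        (if G 1 j ≠ 0 then (1 : ℝ) else 0) := fun j => by positivity
    split_ifs with h
    · obtain ⟨j, h1, h2⟩ := h
      refine le_trans ?_ (Finset.single_le_sum (fun j _ => hnn j) (Finset.mem_univ j))
      simp [h1, h2]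
    · exact Finset.sum_nonneg fun j _ => hnn j
  have h3 : (n : ℝ) ^ 2 * ∑ j : Fin n, ∑ G ∈ Γ, (if G 0 j ≠ 0 then (1 : ℝ) else 0) *
        (if G 1 j ≠ 0 then (1 : ℝ) else 0) ≤ n * ((t : ℝ) ^ 2 * T) := by
    rw [Finset.mul_sum]
    refine (Finset.sum_le_sum fun j _ => hcol j).trans_eq ?_
    simp
  have h4 := (mul_le_mul_of_nonneg_left hle (sq_nonneg (n : ℝ))).trans h3
  rw [sq, mul_assoc] at h4
  exact le_of_mul_le_mul_left h4 hn'

/-- Two given rows of a random matrix of the ensemble meet with probability at most `t² / n`. -/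
theorem sum_rows_meet_le (i i' : Fin k) (hi : i ≠ i') :
    (n : ℝ) * ∑ G ∈ ldgmEnsemble n k t,
      (if ∃ j, G i j ≠ 0 ∧ G i' j ≠ 0 then (1 : ℝ) else 0) ≤
      (t : ℝ) ^ 2 * ((ldgmEnsemble n k t).card : ℝ) := by
  obtain ⟨m, rfl⟩ : ∃ m, k = m + 2 := by
    refine ⟨k - 2, ?_⟩
    have h1 := i.2
    have h2 := i'.2
    have h3 : (i : ℕ) ≠ i' := fun h => hi (Fin.ext h)
    omega
  -- `i''` is the preimage of `i'` under `swap 0 i`, so that `τ` sends `0` to `i` and `1` to `i'`.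
  set i'' := Equiv.swap 0 i i' with hi''
  have h01 : (0 : Fin (m + 2)) ≠ 1 := by simp
  have h0i : (0 : Fin (m + 2)) ≠ i'' := fun h => hi <| by
    refine (Equiv.swap 0 i).injective ?_
    exact (Equiv.swap_apply_right 0 i).trans (h.trans hi'')
  set τ : Equiv.Perm (Fin (m + 2)) := Equiv.swap 0 i * Equiv.swap 1 i'' with hτ
  have hτ0 : τ 0 = i := by
    rw [hτ, Equiv.Perm.mul_apply, Equiv.swap_apply_of_ne_of_ne h01 h0i, Equiv.swap_apply_left]
  have hτ1 : τ 1 = i' := by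
    rw [hτ, Equiv.Perm.mul_apply, Equiv.swap_apply_left, hi'', Equiv.swap_apply_self]
  have := sum_first_rows_meet_le (n := n) (t := t) m
  rw [← sum_submatrix_ldgmEnsemble _ τ (Equiv.refl _)] at this
  simpa [hτ0, hτ1] using this

end Ensemble

/-! ### Noise distribution on the support of a row. -/

section Channel

variable {n : ℕ}

theorem bscProb_eq_zero_sub (p : ℝ) (x y : Fin n → ZMod 2) :
    bscProb p x y = bscProb p 0 (y - x) := by
  simp [bscProb, sub_eq_zero]

theorem bscProb_nonneg {p : ℝ} (hp0 : 0 < p) (hp : p ≤ 1 / 2) (x y : Fin n → ZMod 2) :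
    0 ≤ bscProb p x y :=
  Finset.prod_nonneg fun i _ => by split_ifs <;> linarith

theorem bscProb_zero_eq_pow (p : ℝ) (e : Fin n → ZMod 2) :
    bscProb p 0 e = p ^ hammingNorm e * (1 - p) ^ (n - hammingNorm e) := by
  have h : (Finset.univ.filter fun j => e j = 0).card = n - hammingNorm e := by
    have := Finset.card_filter_add_card_filter_not (s := Finset.univ) fun j => e j = 0
    rw [Finset.card_univ, Fintype.card_fin] at this
    rw [hammingNorm]
    simp only [ne_eq]
    omega
  rw [bscProb, Finset.prod_ite, Finset.prod_const, Finset.prod_const]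
  simp only [Pi.zero_apply]
  rw [h, mul_comm]
  rfl

theorem bscProb_zero_le_of_hammingNorm_le {p : ℝ} (hp0 : 0 < p) (hp : p ≤ 1 / 2)
    {e e' : Fin n → ZMod 2} (h : hammingNorm e' ≤ hammingNorm e) :
    bscProb p 0 e ≤ bscProb p 0 e' := by
  have hn : hammingNorm e ≤ n := hammingNorm_le_card_fintype.trans_eq (Fintype.card_fin n)
  obtain ⟨d, hd⟩ := Nat.exists_eq_add_of_le h
  have h1 : n - hammingNorm e' = d + (n - hammingNorm e) := by omega
  rw [bscProb_zero_eq_pow, bscProb_zero_eq_pow, h1, hd, pow_add, pow_add, mul_assoc]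
  have h2 : p ^ d ≤ (1 - p) ^ d := pow_le_pow_left₀ hp0.le (by linarith) d
  have h3 : 0 < 1 - p := by linarith
  gcongr

theorem hammingNorm_add_add_inter (e g : Fin n → ZMod 2) :
    hammingNorm (e + g) + 2 * (Finset.univ.filter fun j => g j ≠ 0 ∧ e j ≠ 0).card =
      hammingNorm e + hammingNorm g := by
  have h : ∀ a b : ZMod 2, (if a + b ≠ 0 then 1 else 0) + 2 * (if b ≠ 0 ∧ a ≠ 0 then 1 else 0) =
      (if a ≠ 0 then 1 else 0) + (if b ≠ 0 then 1 else 0) := by decide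
  simp only [hammingNorm, Finset.card_filter, Finset.mul_sum, ← Finset.sum_add_distrib,
    Pi.add_apply, h]

theorem sum_bscProb_pattern (p : ℝ) {S A : Finset (Fin n)} (hA : A ⊆ S) :
    ∑ e : Fin n → ZMod 2, bscProb p 0 e * (if ∀ j ∈ S, (e j ≠ 0 ↔ j ∈ A) then 1 else 0) =
      p ^ A.card * (1 - p) ^ (S.card - A.card) := by
  classical
  set T : Fin n → Finset (ZMod 2) := fun j =>
    if j ∈ S then (if j ∈ A then {1} else {0}) else Finset.univ with hT
  have h1 : ∀ e : Fin n → ZMod 2, (∀ j ∈ S, (e j ≠ 0 ↔ j ∈ A)) ↔ e ∈ Fintype.piFinset T := by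
    intro e
    rw [Fintype.mem_piFinset]
    refine forall_congr' fun j => ?_
    have h2 : ∀ a : ZMod 2, a ≠ 0 ↔ a = 1 := by decide
    simp only [hT]
    by_cases hS : j ∈ S
    · by_cases hA : j ∈ A <;> simp [hS, hA, h2]
      have h3 : ∀ a : ZMod 2, ¬ a = 1 ↔ a = 0 := by decide
      rw [h3]
    · simp [hS]
  simp only [h1, mul_ite, mul_one, mul_zero]
  rw [← Finset.sum_filter, Finset.filter_mem_eq_inter, Finset.univ_inter]
  simp only [bscProb, Pi.zero_apply]
  rw [← Finset.prod_univ_sum T fun _ x => if x = 0 then 1 - p else p]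
  have h2 : ∀ j, ∑ x ∈ T j, (if x = 0 then 1 - p else p) =
      if j ∈ S then (if j ∈ A then p else 1 - p) else 1 := by
    intro j
    simp only [hT]
    split_ifs
    · simp
    · simp
    · rw [show (Finset.univ : Finset (ZMod 2)) = {0, 1} from rfl, Finset.sum_pair (by decide)]
      simp
  simp only [h2]
  rw [← Finset.prod_filter, Finset.filter_mem_eq_inter, Finset.univ_inter, Finset.prod_ite,
    Finset.prod_const, Finset.prod_const, Finset.filter_mem_eq_inter,
    Finset.inter_eq_right.2 hA, ← Finset.sdiff_eq_filter, Finset.card_sdiff_of_subset hA]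

theorem sum_bscProb (p : ℝ) : ∑ e : Fin n → ZMod 2, bscProb p 0 e = 1 := by
  simpa using sum_bscProb_pattern p (Finset.Subset.refl (∅ : Finset (Fin n)))

/-- The probability that a binomial variable with parameters `t`, `p` equals `s`. -/
noncomputable def binomProb (p : ℝ) (t s : ℕ) : ℝ := t.choose s * (p ^ s * (1 - p) ^ (t - s))

/-- The noise induces exactly one pattern on `S`, so the size event is a disjoint union of pattern
events, whose probabilities are explicit. -/
theorem indicator_card_eq_sum_pattern (S : Finset (Fin n)) (s : ℕ) (e : Fin n → ZMod 2) :
    (if (S.filter fun j => e j ≠ 0).card = s then (1 : ℝ) else 0) =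
      ∑ A ∈ S.powersetCard s, if ∀ j ∈ S, (e j ≠ 0 ↔ j ∈ A) then 1 else 0 := by
  classical
  have huniq : ∀ A ∈ S.powersetCard s, (∀ j ∈ S, (e j ≠ 0 ↔ j ∈ A)) →
      A = S.filter fun j => e j ≠ 0 := by
    intro A hA h
    ext j
    rw [Finset.mem_filter]
    have hS := (Finset.mem_powersetCard.1 hA).1
    exact ⟨fun hj => ⟨hS hj, (h j (hS hj)).2 hj⟩, fun hj => (h j hj.1).1 hj.2⟩
  split_ifs with h
  · rw [Finset.sum_eq_single_of_mem (S.filter fun j => e j ≠ 0)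
      (Finset.mem_powersetCard.2 ⟨Finset.filter_subset _ _, h⟩), if_pos]
    · intro j hj
      simp [hj]
    · intro A hA hne
      exact if_neg fun h' => hne (huniq A hA h')
  · refine (Finset.sum_eq_zero fun A hA => if_neg fun h' => h ?_).symm
    rw [← huniq A hA h']
    exact (Finset.mem_powersetCard.1 hA).2

theorem sum_bscProb_card_eq (p : ℝ) (S : Finset (Fin n)) (s : ℕ) :
    ∑ e : Fin n → ZMod 2, bscProb p 0 e *
      (if (S.filter fun j => e j ≠ 0).card = s then 1 else 0) = binomProb p S.card s := by
  simp only [indicator_card_eq_sum_pattern, Finset.mul_sum]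
  rw [Finset.sum_comm]
  have : ∀ A ∈ S.powersetCard s, ∑ e : Fin n → ZMod 2, bscProb p 0 e *
      (if ∀ j ∈ S, (e j ≠ 0 ↔ j ∈ A) then 1 else 0) = p ^ s * (1 - p) ^ (S.card - s) := by
    intro A hA
    rw [Finset.mem_powersetCard] at hA
    rw [sum_bscProb_pattern p hA.1, hA.2]
  rw [Finset.sum_congr rfl this, Finset.sum_const, Finset.card_powersetCard, nsmul_eq_mul,
    binomProb]

theorem sum_bscProb_card_eq_of_disjoint (p : ℝ) {S S' : Finset (Fin n)} (h : Disjoint S S')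
    (s : ℕ) :
    ∑ e : Fin n → ZMod 2, bscProb p 0 e *
      ((if (S.filter fun j => e j ≠ 0).card = s then 1 else 0) *
        (if (S'.filter fun j => e j ≠ 0).card = s then 1 else 0)) =
      binomProb p S.card s * binomProb p S'.card s := by
  classical
  simp only [indicator_card_eq_sum_pattern, Finset.sum_mul_sum]
  simp only [Finset.mul_sum]
  rw [Finset.sum_comm, Finset.sum_congr rfl fun A _ => Finset.sum_comm]
  have : ∀ A ∈ S.powersetCard s, ∀ A' ∈ S'.powersetCard s, ∑ e : Fin n → ZMod 2, bscProb p 0 e *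
      ((if ∀ j ∈ S, (e j ≠ 0 ↔ j ∈ A) then 1 else 0) *
        (if ∀ j ∈ S', (e j ≠ 0 ↔ j ∈ A') then 1 else 0)) =
      (p ^ s * (1 - p) ^ (S.card - s)) * (p ^ s * (1 - p) ^ (S'.card - s)) := by
    intro A hA A' hA'
    rw [Finset.mem_powersetCard] at hA hA'
    have hd : Disjoint A A' := h.mono hA.1 hA'.1
    have hpat : ∀ e : Fin n → ZMod 2, (if ∀ j ∈ S, (e j ≠ 0 ↔ j ∈ A) then (1 : ℝ) else 0) *
        (if ∀ j ∈ S', (e j ≠ 0 ↔ j ∈ A') then 1 else 0) =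
        if ∀ j ∈ S ∪ S', (e j ≠ 0 ↔ j ∈ A ∪ A') then 1 else 0 := by
      intro e
      rw [ite_zero_mul_ite_zero, mul_one]
      refine if_congr ?_ rfl rfl
      have h1 : ∀ j ∈ S, j ∉ A' := fun j hj hj' => Finset.disjoint_left.1 h hj (hA'.1 hj')
      have h2 : ∀ j ∈ S', j ∉ A := fun j hj hj' => Finset.disjoint_left.1 h (hA.1 hj') hj
      simp only [Finset.mem_union]
      constructor
      · rintro ⟨h3, h4⟩ j (hj | hj)
        · rw [h3 j hj]; simp [h1 j hj]
        · rw [h4 j hj]; simp [h2 j hj]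
      · intro h3
        refine ⟨fun j hj => ?_, fun j hj => ?_⟩
        · rw [h3 j (Or.inl hj)]; simp [h1 j hj]
        · rw [h3 j (Or.inr hj)]; simp [h2 j hj]
    simp only [hpat]
    rw [sum_bscProb_pattern p (Finset.union_subset_union hA.1 hA'.1),
      Finset.card_union_of_disjoint hd, Finset.card_union_of_disjoint h, hA.2, hA'.2]
    have h1 := Finset.card_le_card hA.1
    have h2 := Finset.card_le_card hA'.1
    rw [show S.card + S'.card - (s + s) = (S.card - s) + (S'.card - s) by omega, pow_add, pow_add]
    ring
  rw [Finset.sum_congr rfl fun A hA => Finset.sum_congr rfl (this A hA)]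
  simp only [Finset.sum_const, Finset.card_powersetCard, nsmul_eq_mul, binomProb]
  ring

/-! ### The second moment bound and the limit on any decoder. -/

/-- Chebyshev's inequality for a sum of events of equal probability on a finite space. -/
theorem sum_lt_half_mean_le {Ω κ : Type*} [Fintype Ω] [Fintype κ] (W : Ω → ℝ)
    (hW : ∀ e, 0 ≤ W e) (hW1 : ∑ e, W e = 1) (b : κ → Ω → ℝ) (q : ℝ) (hq : 0 < q)
    (hk : 0 < Fintype.card κ) (hb : ∀ i, ∑ e, W e * b i e = q) (ρ : κ → κ → ℝ)
    (hρ : ∀ i j, ∑ e, W e * (b i e * b j e) ≤ q ^ 2 + q * ρ i j) :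
    ∑ e, (if ∑ i, b i e < Fintype.card κ * q / 2 then W e else 0) ≤
      4 * (∑ i, ∑ j, ρ i j) / ((Fintype.card κ : ℝ) ^ 2 * q) := by
  set k : ℝ := (Fintype.card κ : ℝ) with hk'
  have hkpos : 0 < k := Nat.cast_pos.2 hk
  have h1 : ∑ e, W e * ∑ i, b i e = k * q := by
    simp only [Finset.mul_sum]
    rw [Finset.sum_comm]
    simp [hb, hk']
  have h2 : ∑ e, W e * (∑ i, b i e) ^ 2 ≤ k ^ 2 * q ^ 2 + q * ∑ i, ∑ j, ρ i j := by
    have : ∀ e, W e * (∑ i, b i e) ^ 2 = ∑ i, ∑ j, W e * (b i e * b j e) := by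
      intro e
      rw [sq, Finset.sum_mul_sum]
      simp only [Finset.mul_sum]
    simp only [this]
    rw [Finset.sum_comm, Finset.sum_congr rfl fun i _ => Finset.sum_comm]
    refine (Finset.sum_le_sum fun i _ => Finset.sum_le_sum fun j _ => hρ i j).trans_eq ?_
    simp only [Finset.sum_add_distrib, ← Finset.mul_sum, Finset.sum_const, Finset.card_univ,
      nsmul_eq_mul, ← hk']
    ring
  have h3 : ∑ e, W e * (∑ i, b i e - k * q) ^ 2 ≤ q * ∑ i, ∑ j, ρ i j := by
    have : ∀ e, W e * (∑ i, b i e - k * q) ^ 2 = W e * (∑ i, b i e) ^ 2 -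
        2 * (k * q) * (W e * ∑ i, b i e) + (k * q) ^ 2 * W e := fun e => by ring
    simp only [this, Finset.sum_add_distrib, Finset.sum_sub_distrib, ← Finset.mul_sum, h1, hW1]
    linarith
  have h4 : ∑ e, (if ∑ i, b i e < k * q / 2 then W e else 0) ≤
      ∑ e, W e * (∑ i, b i e - k * q) ^ 2 * (4 / (k * q) ^ 2) := by
    refine Finset.sum_le_sum fun e _ => ?_
    split_ifs with h
    · have h5 : (k * q) ^ 2 ≤ 4 * (∑ i, b i e - k * q) ^ 2 := by
        have : 0 < k * q := mul_pos hkpos hq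
        nlinarith
      have h6 : 1 ≤ (∑ i, b i e - k * q) ^ 2 * (4 / (k * q) ^ 2) := by
        rw [mul_div_assoc', le_div_iff₀ (by positivity)]
        linarith
      calc W e = W e * 1 := (mul_one _).symm
        _ ≤ W e * ((∑ i, b i e - k * q) ^ 2 * (4 / (k * q) ^ 2)) :=
            mul_le_mul_of_nonneg_left h6 (hW e)
        _ = _ := by ring
    · have := hW e
      positivity
  refine h4.trans ?_
  rw [← Finset.sum_mul]
  calc _ ≤ (q * ∑ i, ∑ j, ρ i j) * (4 / (k * q) ^ 2) :=
        mul_le_mul_of_nonneg_right h3 (by positivity)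
    _ = _ := by field_simp

open Classical in
/-- If, for most noise vectors `e`, there are at least `M` distinct codewords `g i` such that
`e + g i` is at least as likely as `e`, then the error probability of the code is large. -/
theorem one_sub_le_errorProb {p : ℝ} (hp0 : 0 < p) (hp : p ≤ 1 / 2)
    (C : Submodule (ZMod 2) (Fin n → ZMod 2)) {κ : Type*} [Fintype κ]
    (g : κ → Fin n → ZMod 2) (hg : Function.Injective g) (hgC : ∀ i, g i ∈ C)
    (B : κ → (Fin n → ZMod 2) → Prop)
    (hB : ∀ i e, B i e → bscProb p 0 e ≤ bscProb p 0 (e + g i)) (M : ℝ) (hM : 0 < M) :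
    1 - (1 / M + ∑ e, if (∑ i, if B i e then (1 : ℝ) else 0) < M then bscProb p 0 e else 0) ≤
      errorProb p C := by
  set Q : ℝ := ∑ e, if (∑ i, if B i e then (1 : ℝ) else 0) < M then bscProb p 0 e else 0 with hQ
  have hP0 : ∀ e : Fin n → ZMod 2, 0 ≤ bscProb p 0 e := fun e => bscProb_nonneg hp0 hp 0 e
  refine le_ciInf fun D => ?_
  have hcard : (Fintype.card C : ℝ) = (Nat.card C : ℝ) := by rw [Nat.card_eq_fintype_card]
  have hCpos : (0 : ℝ) < (Nat.card C : ℝ) := Nat.cast_pos.2 Nat.card_pos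
  rw [avgErrorProb, le_div_iff₀ hCpos]
  simp only [bscProb_eq_zero_sub p (Subtype.val _)]
  have htrans : ∀ (F : (Fin n → ZMod 2) → ℝ) (c : Fin n → ZMod 2), ∑ y, F (y - c) = ∑ y, F y :=
    fun F c => (Equiv.subRight c).sum_comp F
  have hS : ∑ c : C, ∑ y : Fin n → ZMod 2,
      (if D y = (c : Fin n → ZMod 2) then bscProb p 0 (y - c.1) else 0) ≤
      (Nat.card C : ℝ) * (1 / M + Q) := by
    -- Either the noise `y - c` is exceptional and is charged to `Q`, or at least `M` codewords `c -
    -- g i` are at least as likely as `c`, whence the likelihood of `c` is at most `1 / M` of the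
    -- total over the code.
    have hsplit : ∀ (c : C) (y : Fin n → ZMod 2),
        (if D y = (c : Fin n → ZMod 2) then bscProb p 0 (y - c.1) else 0) ≤
        (if (∑ i, if B i (y - c.1) then (1 : ℝ) else 0) < M then bscProb p 0 (y - c.1) else 0) +
        (if D y = (c : Fin n → ZMod 2) then (1 / M) * ∑ c' : C, bscProb p 0 (y - c'.1) else 0) := by
      intro c y
      have hnn : 0 ≤ (1 / M) * ∑ c' : C, bscProb p 0 (y - c'.1) :=
        mul_nonneg (by positivity) (Finset.sum_nonneg fun c' _ => hP0 _)
      by_cases h1 : D y = (c : Fin n → ZMod 2)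
      · rw [if_pos h1, if_pos h1]
        by_cases h2 : (∑ i, if B i (y - c.1) then (1 : ℝ) else 0) < M
        · rw [if_pos h2]; linarith
        · rw [if_neg h2, zero_add, one_div, ← div_eq_inv_mul, le_div_iff₀ hM]
          push Not at h2
          set φ : κ → C := fun i => c - ⟨g i, hgC i⟩ with hφ
          have hφinj : Function.Injective φ := fun i i' h => hg <| by
            simpa [hφ, Subtype.ext_iff] using h
          calc bscProb p 0 (y - c.1) * M
              ≤ bscProb p 0 (y - c.1) * ∑ i, (if B i (y - c.1) then (1 : ℝ) else 0) :=
                mul_le_mul_of_nonneg_left h2 (hP0 _)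
            _ ≤ ∑ i, bscProb p 0 (y - (φ i).1) := by
                rw [Finset.mul_sum]
                refine Finset.sum_le_sum fun i _ => ?_
                split_ifs with h3
                · have h4 := hB i _ h3
                  have h5 : y - (φ i).1 = y - c.1 + g i := by
                    simp only [hφ, Submodule.coe_sub]; abel
                  rw [h5, mul_one]; exact h4
                · rw [mul_zero]; exact hP0 _
            _ = ∑ c' ∈ Finset.univ.image φ, bscProb p 0 (y - c'.1) :=
                (Finset.sum_image (f := fun c' : C => bscProb p 0 (y - c'.1))
                  fun i _ i' _ h => hφinj h).symm
            _ ≤ ∑ c' : C, bscProb p 0 (y - c'.1) :=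
                Finset.sum_le_univ_sum_of_nonneg fun c' => hP0 _
      · rw [if_neg h1, if_neg h1, add_zero]
        split_ifs
        exacts [hP0 _, le_rfl]
    refine (Finset.sum_le_sum fun c _ => Finset.sum_le_sum fun y _ => hsplit c y).trans ?_
    simp only [Finset.sum_add_distrib]
    have hfirst : ∑ c : C, ∑ y : Fin n → ZMod 2,
        (if (∑ i, if B i (y - c.1) then (1 : ℝ) else 0) < M then bscProb p 0 (y - c.1) else 0) =
        (Nat.card C : ℝ) * Q := by
      rw [Finset.sum_congr rfl fun (c : C) _ => htrans (fun e =>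
        if (∑ i, if B i e then (1 : ℝ) else 0) < M then bscProb p 0 e else 0) c.1]
      rw [Finset.sum_const, nsmul_eq_mul, Finset.card_univ, hcard]
    -- For each `y` at most one codeword equals `D y`, and none does if `D y` lies outside the code.
    have hsecond : ∑ c : C, ∑ y : Fin n → ZMod 2,
        (if D y = (c : Fin n → ZMod 2) then (1 / M) * ∑ c' : C, bscProb p 0 (y - c'.1) else 0) ≤
        (Nat.card C : ℝ) * (1 / M) := by
      rw [Finset.sum_comm]
      calc _ ≤ ∑ y : Fin n → ZMod 2, (1 / M) * ∑ c' : C, bscProb p 0 (y - c'.1) := by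
            refine Finset.sum_le_sum fun y _ => ?_
            have hnn : 0 ≤ (1 / M) * ∑ c' : C, bscProb p 0 (y - c'.1) :=
              mul_nonneg (by positivity) (Finset.sum_nonneg fun c' _ => hP0 _)
            by_cases hy : D y ∈ C
            · rw [Finset.sum_eq_single_of_mem (⟨D y, hy⟩ : C) (Finset.mem_univ _)]
              · simp
              · intro c _ hc
                exact if_neg fun h => hc (Subtype.ext h.symm)
            · rw [Finset.sum_eq_zero fun (c : C) _ => if_neg fun h : D y = c.1 =>
                hy (h.symm ▸ c.2)]
              exact hnn
        _ = (Nat.card C : ℝ) * (1 / M) := by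
            rw [← Finset.mul_sum, Finset.sum_comm,
              Finset.sum_congr rfl fun (c : C) _ => htrans (fun e => bscProb p 0 e) c.1]
            simp only [sum_bscProb, Finset.sum_const, nsmul_eq_mul, Finset.card_univ, hcard]
            ring
    rw [hfirst]
    linarith
  have hcompl : ∑ c : C, ∑ y : Fin n → ZMod 2,
      (if D y = (c : Fin n → ZMod 2) then 0 else bscProb p 0 (y - c.1)) =
      (Nat.card C : ℝ) - ∑ c : C, ∑ y : Fin n → ZMod 2,
        (if D y = (c : Fin n → ZMod 2) then bscProb p 0 (y - c.1) else 0) := by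
    have h1 : ∑ c : C, ∑ y : Fin n → ZMod 2, bscProb p 0 (y - c.1) = (Nat.card C : ℝ) := by
      rw [Finset.sum_congr rfl fun (c : C) _ => htrans (fun e => bscProb p 0 e) c.1]
      simp only [sum_bscProb, Finset.sum_const, nsmul_eq_mul, Finset.card_univ, hcard, mul_one]
    rw [← h1, ← Finset.sum_sub_distrib]
    refine Finset.sum_congr rfl fun c _ => ?_
    rw [← Finset.sum_sub_distrib]
    refine Finset.sum_congr rfl fun y _ => ?_
    split_ifs <;> simp
  rw [hcompl]
  linarith

end Channel

/-! ### Lower bound for the central binomial probability. -/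

section LowerBound

/-- The inductive step comes down to `4(m + 1)(m + 2) ≤ (2m + 3)²`. -/
theorem sixteen_pow_le_mul_centralBinom_sq (m : ℕ) :
    16 ^ (m + 1) ≤ 4 * (m + 1) * (m + 1).centralBinom ^ 2 := by
  induction m with
  | zero => decide
  | succ m ih =>
    have h := Nat.succ_mul_centralBinom_succ (m + 1)
    set a := (m + 1).centralBinom
    set b := (m + 1 + 1).centralBinom
    have h1 : (m + 2) * 16 ^ (m + 2) ≤ (m + 2) * (4 * (m + 2) * b ^ 2) := by
      calc (m + 2) * 16 ^ (m + 2) = 16 * (m + 2) * 16 ^ (m + 1) := by ring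
        _ ≤ 16 * (m + 2) * (4 * (m + 1) * a ^ 2) := Nat.mul_le_mul_left _ ih
        _ ≤ 4 * (2 * (2 * (m + 1) + 1) * a) ^ 2 := by nlinarith [sq_nonneg a]
        _ = 4 * ((m + 1 + 1) * b) ^ 2 := by rw [← h]
        _ = _ := by ring
    exact Nat.le_of_mul_le_mul_left h1 (by omega)

theorem four_pow_le_mul_sqrt {m : ℕ} (hm : 0 < m) :
    (4 : ℝ) ^ m ≤ m.centralBinom * (2 * √m) := by
  obtain ⟨m, rfl⟩ := Nat.exists_eq_succ_of_ne_zero hm.ne'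
  have h := sixteen_pow_le_mul_centralBinom_sq m
  have h' : (16 : ℝ) ^ (m + 1) ≤ 4 * (m + 1) * ((m + 1).centralBinom : ℝ) ^ 2 := by
    exact_mod_cast h
  refine le_of_sq_le_sq ?_ (by positivity)
  rw [mul_pow, mul_pow, Real.sq_sqrt (by positivity), ← pow_mul, mul_comm (m.succ) 2, pow_mul]
  push_cast
  norm_num
  linarith

theorem two_rpow_neg_lambdaBSC_mul {p : ℝ} (hp0 : 0 < p) (hp : p ≤ 1 / 2) (t : ℕ) :
    (2 : ℝ) ^ (-(lambdaBSC p * t)) = (2 * √(p * (1 - p))) ^ t := by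
  have hq : 0 < 1 - p := by linarith
  have h : (2 : ℝ) ^ (-lambdaBSC p) = 2 * √(p * (1 - p)) := by
    have : -lambdaBSC p = Real.logb 2 (2 * √(p * (1 - p))) := by
      rw [Real.logb_mul (by norm_num) (by positivity), Real.sqrt_eq_rpow,
        Real.logb_rpow_eq_mul_logb_of_pos (by positivity), Real.logb_mul hp0.ne' hq.ne',
        Real.logb_self_eq_one (by norm_num), lambdaBSC]
      ring
    rw [this, Real.rpow_logb (by norm_num) (by norm_num) (by positivity)]
  rw [← neg_mul, Real.rpow_mul (by norm_num), h, Real.rpow_natCast]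

theorem lambdaBSC_nonneg_pos {p : ℝ} (hp0 : 0 < p) (hp : p ≤ 1 / 2) :
    0 ≤ lambdaBSC p ∧ (p < 1 / 2 → 0 < lambdaBSC p) := by
  have hq : 0 < 1 - p := by linarith
  have h : lambdaBSC p = -(1 / 2) * Real.logb 2 (4 * (p * (1 - p))) := by
    rw [Real.logb_mul (by norm_num) (by positivity), Real.logb_mul hp0.ne' hq.ne', lambdaBSC,
      show (4 : ℝ) = 2 ^ (2 : ℝ) by norm_num, Real.logb_rpow (by norm_num) (by norm_num)]
    ring
  rw [h]
  constructor
  · have := Real.logb_nonpos (b := 2) (by norm_num) (by positivity : 0 ≤ 4 * (p * (1 - p)))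
      (by nlinarith [sq_nonneg (1 - 2 * p)])
    linarith
  · intro hlt
    have := Real.logb_neg (b := 2) (by norm_num) (by positivity : 0 < 4 * (p * (1 - p)))
      (by nlinarith [mul_pos (sub_pos.2 hlt) (sub_pos.2 hlt)])
    linarith

/-- A binomial variable takes its central value with probability of order `2 ^ (-λₚ t) / √t`. -/
theorem le_binomProb {p : ℝ} (hp0 : 0 < p) (hp : p ≤ 1 / 2) {t : ℕ} (ht : 0 < t) :
    p * 2 ^ (-(lambdaBSC p * t)) / √t ≤ binomProb p t ((t + 1) / 2) := by
  have hq : 0 < 1 - p := by linarith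
  have ht' : (0 : ℝ) < t := Nat.cast_pos.2 ht
  rw [two_rpow_neg_lambdaBSC_mul hp0 hp, div_le_iff₀ (Real.sqrt_pos.2 ht')]
  set w := √(p * (1 - p)) with hw
  have hw2 : (2 * w) ^ 2 = 4 * (p * (1 - p)) := by
    rw [mul_pow, hw, Real.sq_sqrt (by positivity)]; norm_num
  have hw0 : 0 ≤ w := Real.sqrt_nonneg _
  have hw1 : 2 * w ≤ 1 := by
    refine le_of_sq_le_sq ?_ zero_le_one
    rw [hw2]; nlinarith [sq_nonneg (1 - 2 * p)]
  obtain ⟨m, rfl | rfl⟩ := Nat.even_or_odd' t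
  · have hm : 0 < m := by omega
    rw [pow_mul, hw2, show (2 * m + 1) / 2 = m by omega, binomProb, show 2 * m - m = m by omega,
      ← mul_pow, mul_pow 4]
    have h1 := four_pow_le_mul_sqrt hm
    rw [Nat.centralBinom] at h1
    have h2 : √(m : ℝ) ≤ √((2 * m : ℕ) : ℝ) :=
      Real.sqrt_le_sqrt (by push_cast; linarith [(Nat.cast_nonneg m : (0 : ℝ) ≤ m)])
    have h3 : p * 4 ^ m ≤ ((2 * m).choose m : ℝ) * √((2 * m : ℕ) : ℝ) := by
      calc p * 4 ^ m ≤ 1 / 2 * (((2 * m).choose m : ℝ) * (2 * √m)) := by gcongr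
        _ = ((2 * m).choose m : ℝ) * √m := by ring
        _ ≤ _ := by gcongr
    calc p * (4 ^ m * (p * (1 - p)) ^ m) = (p * 4 ^ m) * (p * (1 - p)) ^ m := by ring
      _ ≤ (((2 * m).choose m : ℝ) * √((2 * m : ℕ) : ℝ)) * (p * (1 - p)) ^ m := by gcongr
      _ = _ := by ring
  -- For odd `t` the success count exceeds the failure count by one, which leaves the unpaired `p`
  -- in the bound; the extra factor `2 * w` is at most `1`.
  · rw [show (2 * m + 1 + 1) / 2 = m + 1 by omega, binomProb,
      show 2 * m + 1 - (m + 1) = m by omega]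
    have h1 := four_pow_le_mul_sqrt (Nat.succ_pos m)
    have hcb : ((m + 1).centralBinom : ℝ) = 2 * ((2 * m + 1).choose (m + 1) : ℝ) := by
      have : (m + 1).centralBinom = 2 * (2 * m + 1).choose (m + 1) := by
        rw [Nat.centralBinom, show 2 * (m + 1) = 2 * m + 1 + 1 by ring, Nat.choose_succ_succ,
          Nat.choose_symm_half]
        ring
      rw [this]; push_cast; ring
    rw [Nat.succ_eq_add_one, hcb, pow_succ] at h1
    have h2 : √((m + 1 : ℕ) : ℝ) ≤ √((2 * m + 1 : ℕ) : ℝ) :=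
      Real.sqrt_le_sqrt (by push_cast; linarith [(Nat.cast_nonneg m : (0 : ℝ) ≤ m)])
    have h3 : (4 : ℝ) ^ m ≤ ((2 * m + 1).choose (m + 1) : ℝ) * √((2 * m + 1 : ℕ) : ℝ) := by
      calc (4 : ℝ) ^ m ≤ ((2 * m + 1).choose (m + 1) : ℝ) * √((m + 1 : ℕ) : ℝ) := by linarith
        _ ≤ _ := by gcongr
    calc p * (2 * w) ^ (2 * m + 1) = p * ((4 * (p * (1 - p))) ^ m * (2 * w)) := by
          rw [pow_succ, pow_mul, hw2]
      _ ≤ p * ((4 * (p * (1 - p))) ^ m * 1) := by gcongr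
      _ = 4 ^ m * (p * (p * (1 - p)) ^ m) := by rw [mul_pow]; ring
      _ ≤ (((2 * m + 1).choose (m + 1) : ℝ) * √((2 * m + 1 : ℕ) : ℝ)) *
          (p * (p * (1 - p)) ^ m) := by gcongr
      _ = _ := by rw [mul_pow, pow_succ]; ring

end LowerBound

/-! ### From typical noise to typical matrices. -/

section Proportion

variable {n k t : ℕ}

open Classical in
/-- The number of ordered pairs of distinct rows of `G` with intersecting supports. -/
noncomputable def meetCount (G : Matrix (Fin k) (Fin n) (ZMod 2)) : ℝ :=
  ∑ i, ∑ i', if i ≠ i' ∧ ∃ j, G i j ≠ 0 ∧ G i' j ≠ 0 then 1 else 0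

theorem sum_meetCount_le : (n : ℝ) * ∑ G ∈ ldgmEnsemble n k t, meetCount G ≤
    (k : ℝ) ^ 2 * ((t : ℝ) ^ 2 * ((ldgmEnsemble n k t).card : ℝ)) := by
  classical
  simp only [meetCount]
  rw [Finset.sum_comm, Finset.sum_congr rfl fun i _ => Finset.sum_comm]
  simp only [Finset.mul_sum]
  calc _ ≤ ∑ i : Fin k, ∑ i' : Fin k, (t : ℝ) ^ 2 * ((ldgmEnsemble n k t).card : ℝ) := by
        refine Finset.sum_le_sum fun i _ => Finset.sum_le_sum fun i' _ => ?_
        rw [← Finset.mul_sum]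
        by_cases h : i = i'
        · simp only [h, ne_eq, not_true_eq_false, false_and, if_false, Finset.sum_const_zero,
            mul_zero]
          positivity
        · simp only [ne_eq, h, not_false_eq_true, true_and]
          convert sum_rows_meet_le (n := n) (t := t) i i' h
    _ = _ := by simp; ring

theorem one_sub_le_errorProb_rowCode {p : ℝ} (hp0 : 0 < p) (hp : p ≤ 1 / 2)
    {G : Matrix (Fin k) (Fin n) (ZMod 2)} (hG : G ∈ ldgmEnsemble n k t) (hk : 0 < k) {s : ℕ}
    (hs : t ≤ 2 * s) (hq : 0 < binomProb p t s) :
    1 - (2 / (k * binomProb p t s) + 4 * (k + meetCount G) / ((k : ℝ) ^ 2 * binomProb p t s)) ≤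
      errorProb p (rowCode G) := by
  classical
  set q := binomProb p t s with hqdef
  have hk' : (0 : ℝ) < k := Nat.cast_pos.2 hk
  have hwt := (mem_ldgmEnsemble.1 hG).1
  set S : Fin k → Finset (Fin n) := fun i => Finset.univ.filter fun j => G i j ≠ 0 with hS
  have hScard : ∀ i, (S i).card = t := hwt
  set B : Fin k → (Fin n → ZMod 2) → Prop := fun i e =>
    ((S i).filter fun j => e j ≠ 0).card = s with hB
  have hlik : ∀ i e, B i e → bscProb p 0 e ≤ bscProb p 0 (e + G i) := by
    intro i e h
    refine bscProb_zero_le_of_hammingNorm_le hp0 hp ?_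
    have h1 := hammingNorm_add_add_inter e (G i)
    rw [← Finset.filter_filter, hwt i] at h1
    have h2 : (Finset.filter (fun j => e j ≠ 0)
      (Finset.filter (fun j => G i j ≠ 0) Finset.univ)).card = s := h
    omega
  have hmain := one_sub_le_errorProb hp0 hp (rowCode G) (fun i => G i)
    (linearIndependent_of_mem_ldgmEnsemble hG).injective
    (fun i => Submodule.subset_span ⟨i, rfl⟩) B hlik (k * q / 2) (by positivity)
  -- Disjoint rows have joint probability `q²`. For equal or meeting rows it is at most `q`, so they
  -- get `ρ = 1`, and `ρ` sums to `k + meetCount G`.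
  have hcheb := sum_lt_half_mean_le (fun e : Fin n → ZMod 2 => bscProb p 0 e)
    (fun e => bscProb_nonneg hp0 hp 0 e) (sum_bscProb p)
    (fun (i : Fin k) e => if B i e then (1 : ℝ) else 0) q hq (by simpa using hk)
    (fun i => by rw [hqdef, ← hScard i]; exact sum_bscProb_card_eq p (S i) s)
    (fun i i' => (if i = i' then 1 else 0) +
      if i ≠ i' ∧ ∃ j, G i j ≠ 0 ∧ G i' j ≠ 0 then 1 else 0) (by
      intro i i'
      by_cases hdis : Disjoint (S i) (S i')
      · have h1 := sum_bscProb_card_eq_of_disjoint p hdis s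
        rw [hScard, hScard, ← hqdef] at h1
        refine h1.le.trans ?_
        have : 0 ≤ q * ((if i = i' then 1 else 0) +
          if i ≠ i' ∧ ∃ j, G i j ≠ 0 ∧ G i' j ≠ 0 then 1 else 0) := by positivity
        linarith [sq q]
      · have h1 : ∃ j, G i j ≠ 0 ∧ G i' j ≠ 0 := by
          obtain ⟨j, hj, hj'⟩ := Finset.not_disjoint_iff.1 hdis
          exact ⟨j, (Finset.mem_filter.1 hj).2, (Finset.mem_filter.1 hj').2⟩
        have h2 : (if i = i' then (1 : ℝ) else 0) +
            (if i ≠ i' ∧ ∃ j, G i j ≠ 0 ∧ G i' j ≠ 0 then 1 else 0) = 1 := by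
          by_cases h : i = i'
          · simp [h]
          · simp only [h, if_false, ne_eq, not_false_eq_true, true_and, zero_add]
            exact if_pos h1
        rw [h2, mul_one]
        have h3 : ∑ e : Fin n → ZMod 2, bscProb p 0 e *
            ((if B i e then 1 else 0) * (if B i' e then 1 else 0)) ≤
            ∑ e : Fin n → ZMod 2, bscProb p 0 e * (if B i e then 1 else 0) := by
          refine Finset.sum_le_sum fun e _ => ?_
          refine mul_le_mul_of_nonneg_left ?_ (bscProb_nonneg hp0 hp 0 e)
          split_ifs <;> norm_num
        have h4 : ∑ e : Fin n → ZMod 2, bscProb p 0 e * (if B i e then 1 else 0) = q := by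
          rw [hqdef, ← hScard i]; exact sum_bscProb_card_eq p (S i) s
        rw [h4] at h3
        linarith [sq_nonneg q])
  simp only [Finset.sum_add_distrib, Finset.sum_ite_eq, Finset.mem_univ, if_true,
    Finset.sum_const, Finset.card_univ, Fintype.card_fin, nsmul_eq_mul, mul_one] at hcheb
  have h5 : (1 : ℝ) / (k * q / 2) = 2 / (k * q) := by field_simp
  rw [h5] at hmain
  have h6 : meetCount G =
      ∑ i, ∑ i', if i ≠ i' ∧ ∃ j, G i j ≠ 0 ∧ G i' j ≠ 0 then (1 : ℝ) else 0 := rfl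
  rw [← h6] at hcheb
  refine le_trans (sub_le_sub_left (add_le_add le_rfl ?_) _) hmain
  refine le_of_eq_of_le (Finset.sum_congr rfl fun e _ => ?_) hcheb
  congr!

open Classical in
theorem proportion_le_of_bounds {p : ℝ} (hp0 : 0 < p) (hp : p ≤ 1 / 2) (hk : 0 < k) (hn : 0 < n)
    {s : ℕ} (hs : t ≤ 2 * s) (hq : 0 < binomProb p t s) {ε : ℝ} (hε : 0 < ε)
    (h1 : 12 ≤ ε * (k * binomProb p t s))
    (h2 : 8 * (t : ℝ) ^ 2 ≤ ε ^ 2 * (n * binomProb p t s)) :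
    (1 - ε) * ((ldgmEnsemble n k t).card : ℝ) ≤
      (((ldgmEnsemble n k t).filter fun G => 1 - ε ≤ errorProb p (rowCode G)).card : ℝ) := by
  set q := binomProb p t s with hqdef
  set Γ := ldgmEnsemble n k t with hΓ
  have hk' : (0 : ℝ) < k := Nat.cast_pos.2 hk
  have hn' : (0 : ℝ) < n := Nat.cast_pos.2 hn
  set bad := Γ.filter fun G => ¬ 1 - ε ≤ errorProb p (rowCode G) with hbad
  have hmeet0 : ∀ G : Matrix (Fin k) (Fin n) (ZMod 2), 0 ≤ meetCount G := fun G =>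
    Finset.sum_nonneg fun i _ => Finset.sum_nonneg fun i' _ => by split_ifs <;> norm_num
  -- By `h1` the terms not involving `meetCount G` total at most `ε / 2`, so in a bad matrix the
  -- meeting pairs account for the other `ε / 2`. Markov's inequality then bounds the number of bad
  -- matrices.
  have hbadG : ∀ G ∈ bad, ε * k ^ 2 * q / 8 ≤ meetCount G := by
    intro G hG
    obtain ⟨hGΓ, hGb⟩ := Finset.mem_filter.1 hG
    have h3 := one_sub_le_errorProb_rowCode hp0 hp hGΓ hk hs hq
    rw [← hqdef] at h3
    push Not at hGb
    have h4 : ε < 2 / (k * q) + 4 * (k + meetCount G) / ((k : ℝ) ^ 2 * q) := by linarith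
    have h5 : 2 / (k * q) + 4 * (k + meetCount G) / ((k : ℝ) ^ 2 * q) =
        (6 * k + 4 * meetCount G) / ((k : ℝ) ^ 2 * q) := by field_simp; ring
    rw [h5, lt_div_iff₀ (by positivity)] at h4
    have h6 : 12 * k ≤ ε * (k ^ 2 * q) := by
      calc 12 * (k : ℝ) ≤ ε * (k * q) * k := by gcongr
        _ = _ := by ring
    linarith
  have h3 : (bad.card : ℝ) * (ε * k ^ 2 * q / 8) ≤ ∑ G ∈ Γ, meetCount G := by
    calc (bad.card : ℝ) * (ε * k ^ 2 * q / 8) = ∑ G ∈ bad, (ε * k ^ 2 * q / 8) := by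
          rw [Finset.sum_const, nsmul_eq_mul]
      _ ≤ ∑ G ∈ bad, meetCount G := Finset.sum_le_sum hbadG
      _ ≤ _ := Finset.sum_le_sum_of_subset_of_nonneg (Finset.filter_subset _ _)
          fun G _ _ => hmeet0 G
  have h4 := (mul_le_mul_of_nonneg_left h3 hn'.le).trans sum_meetCount_le
  have h5 : (bad.card : ℝ) ≤ ε * Γ.card := by
    have h6 : (k ^ 2 * (ε * (n * q))) * (bad.card : ℝ) ≤
        (k ^ 2 * (ε * (n * q))) * (ε * Γ.card) := by
      calc (k ^ 2 * (ε * (n * q))) * (bad.card : ℝ)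
          = 8 * (n * ((bad.card : ℝ) * (ε * k ^ 2 * q / 8))) := by ring
        _ ≤ 8 * ((k : ℝ) ^ 2 * ((t : ℝ) ^ 2 * (Γ.card : ℝ))) := by linarith
        _ = k ^ 2 * Γ.card * (8 * (t : ℝ) ^ 2) := by ring
        _ ≤ k ^ 2 * Γ.card * (ε ^ 2 * (n * q)) := by gcongr
        _ = _ := by ring
    exact le_of_mul_le_mul_left h6 (by positivity)
  have h6 := Finset.card_filter_add_card_filter_not (s := Γ)
    fun G => 1 - ε ≤ errorProb p (rowCode G)
  have h7 : ((Γ.filter fun G => 1 - ε ≤ errorProb p (rowCode G)).card : ℝ) + (bad.card : ℝ) =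
      Γ.card := by exact_mod_cast h6
  linarith

/-- At `p = 1/2` all noise vectors are equally likely, so every row competes for every noise vector.
-/
theorem one_sub_inv_le_errorProb_half {G : Matrix (Fin k) (Fin n) (ZMod 2)}
    (hG : G ∈ ldgmEnsemble n k t) (hk : 0 < k) :
    1 - 1 / (k : ℝ) ≤ errorProb (1 / 2) (rowCode G) := by
  classical
  have h := one_sub_le_errorProb (p := 1 / 2) (by norm_num) le_rfl (rowCode G) (fun i => G i)
    (linearIndependent_of_mem_ldgmEnsemble hG).injective
    (fun i => Submodule.subset_span ⟨i, rfl⟩) (fun _ _ => True)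
    (fun i e _ => by simp only [bscProb]; norm_num) k (Nat.cast_pos.2 hk)
  simpa using h

theorem ldgmEnsemble_weight_zero (hk : 0 < k) : ldgmEnsemble n k 0 = ∅ := by
  refine Finset.eq_empty_of_forall_notMem fun G hG => ?_
  exact (linearIndependent_of_mem_ldgmEnsemble hG).ne_zero ⟨0, hk⟩
    (hammingNorm_eq_zero.1 ((mem_ldgmEnsemble.1 hG).1 ⟨0, hk⟩))

end Proportion

/-! ### Asymptotics: checking the two numerical conditions uniformly in `k` and `t`. -/

open Classical in
theorem mainTheorem6 (p α : ℝ) (hp0 : 0 < p) (hp : p ≤ 1 / 2) (hα : α < 1 / 2)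
    (ω : ℕ → ℝ) (hω : Tendsto ω atTop atTop) (ε : ℝ) (hε : 0 < ε) :
    ∀ᶠ n : ℕ in atTop, ∀ k t : ℕ, (n : ℝ) ^ α < (k : ℝ) →
      lambdaBSC p * (t : ℝ) ≤
        α * Real.logb 2 n - 1 / 2 * Real.logb 2 (Real.logb 2 n) - ω n →
      (1 - ε) * ((ldgmEnsemble n k t).card : ℝ) ≤
        (((ldgmEnsemble n k t).filter fun G => 1 - ε ≤ errorProb p (rowCode G)).card : ℝ) := by
  obtain ⟨hlam0, hlampos⟩ := lambdaBSC_nonneg_pos hp0 hp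
  have hL : ∀ᶠ n : ℕ in atTop, 1 ≤ Real.logb 2 n :=
    ((Real.tendsto_logb_atTop (by norm_num)).comp tendsto_natCast_atTop_atTop).eventually_ge_atTop 1
  rcases le_or_gt α 0 with hα0 | hα0
  -- For `α ≤ 0` the upper bound on `λ_p t` is eventually negative, so no `t` qualifies.
  · filter_upwards [hL, hω.eventually_gt_atTop 0] with n hn hωn k t _ hcond
    have h1 := Real.logb_nonneg (b := 2) (by norm_num) hn
    have h2 : 0 ≤ lambdaBSC p * (t : ℝ) := by positivity
    nlinarith
  rcases hp.eq_or_lt with rfl | hplt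
  · have hk : ∀ᶠ n : ℕ in atTop, 1 / ε ≤ (n : ℝ) ^ α :=
      ((tendsto_rpow_atTop hα0).comp tendsto_natCast_atTop_atTop).eventually_ge_atTop _
    filter_upwards [hk] with n hn k t hkn _
    have hkpos : (0 : ℝ) < k := lt_of_le_of_lt (by positivity) hkn
    rw [Finset.filter_true_of_mem]
    · nlinarith [(Nat.cast_nonneg (ldgmEnsemble n k t).card : (0 : ℝ) ≤ _)]
    · intro G hG
      have h1 := one_sub_inv_le_errorProb_half hG (Nat.cast_pos.1 hkpos)
      have h2 : 1 / (k : ℝ) ≤ ε := by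
        rw [div_le_iff₀ hkpos]
        rw [div_le_iff₀ hε] at hn
        nlinarith
      linarith
  have hlam := hlampos hplt
  -- Since `t ≤ (α / λ_p) L`, the factor `1 / √t` costs `√(α / λ_p)`, absorbed in `c`, and `√L`,
  -- cancelled by the `½ log log n` margin. This gives `q ≥ c n^(-α) 2^ω(n)`.
  set c : ℝ := p / √(α / lambdaBSC p) with hc
  have hcpos : 0 < c := by positivity
  -- Chosen so that `8 (α / λ_p)² δ² = ε² c`; then `L ≤ δ n^((1 - α)/2)` yields `8 t² ≤ ε² n q`.
  set δ : ℝ := √(ε ^ 2 * c / (8 * (α / lambdaBSC p) ^ 2)) with hδ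
  have hδpos : 0 < δ := by positivity
  have hpow : ∀ᶠ n : ℕ in atTop, 12 / (ε * c) ≤ (2 : ℝ) ^ ω n :=
    ((tendsto_rpow_atTop_of_base_gt_one 2 (by norm_num)).comp hω).eventually_ge_atTop _
  have hlog : ∀ᶠ n : ℕ in atTop, Real.logb 2 n ≤ δ * (n : ℝ) ^ ((1 - α) / 2) := by
    have h1 := (isLittleO_log_rpow_atTop (show 0 < (1 - α) / 2 by linarith)).comp_tendsto
      (tendsto_natCast_atTop_atTop (R := ℝ))
    have hl2 : 0 < Real.log 2 := Real.log_pos (by norm_num)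
    filter_upwards [h1.def (show 0 < δ * Real.log 2 by positivity), eventually_ge_atTop 1]
      with n hn hn1
    simp only [Function.comp_apply, Real.norm_eq_abs] at hn
    rw [abs_of_nonneg (by positivity : (0 : ℝ) ≤ (n : ℝ) ^ ((1 - α) / 2))] at hn
    rw [Real.logb, div_le_iff₀ hl2]
    calc Real.log n ≤ |Real.log n| := le_abs_self _
      _ ≤ _ := hn
      _ = _ := by ring
  filter_upwards [hL, hω.eventually_ge_atTop 0, hpow, hlog, eventually_gt_atTop 0]
    with n hLn hωn hpown hlogn hn k t hkn hcond
  have hn' : (0 : ℝ) < n := Nat.cast_pos.2 hn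
  have hkpos : (0 : ℝ) < k := lt_of_le_of_lt (by positivity) hkn
  have hk : 0 < k := Nat.cast_pos.1 hkpos
  rcases Nat.eq_zero_or_pos t with rfl | ht
  · simp [ldgmEnsemble_weight_zero hk]
  have ht' : (0 : ℝ) < t := Nat.cast_pos.2 ht
  set L := Real.logb 2 n with hLdef
  have hLpos : 0 < L := by linarith
  have hLL : 0 ≤ Real.logb 2 L := Real.logb_nonneg (by norm_num) hLn
  have htL : (t : ℝ) ≤ α / lambdaBSC p * L := by
    rw [div_mul_eq_mul_div, le_div_iff₀ hlam]
    linarith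
  have hexp : (n : ℝ) ^ (-α) * √L * 2 ^ ω n ≤ 2 ^ (-(lambdaBSC p * t)) := by
    have h1 : (n : ℝ) ^ (-α) = 2 ^ (-α * L) := by
      rw [mul_comm, Real.rpow_mul (by norm_num), hLdef,
        Real.rpow_logb (by norm_num) (by norm_num) hn']
    have h2 : √L = 2 ^ (1 / 2 * Real.logb 2 L) := by
      rw [mul_comm, Real.rpow_mul (by norm_num), Real.rpow_logb (by norm_num) (by norm_num) hLpos,
        Real.sqrt_eq_rpow]
    rw [h1, h2, ← Real.rpow_add (by norm_num), ← Real.rpow_add (by norm_num)]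
    exact Real.rpow_le_rpow_of_exponent_le (by norm_num) (by linarith)
  have hqlow : c * (n : ℝ) ^ (-α) * 2 ^ ω n ≤ binomProb p t ((t + 1) / 2) := by
    refine le_trans ?_ (le_binomProb hp0 hp ht)
    rw [le_div_iff₀ (Real.sqrt_pos.2 ht')]
    have h1 : √(t : ℝ) ≤ √(α / lambdaBSC p) * √L := by
      rw [← Real.sqrt_mul (by positivity)]
      exact Real.sqrt_le_sqrt htL
    calc c * (n : ℝ) ^ (-α) * 2 ^ ω n * √t
        ≤ c * (n : ℝ) ^ (-α) * 2 ^ ω n * (√(α / lambdaBSC p) * √L) := by gcongr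
      _ = (c * √(α / lambdaBSC p)) * ((n : ℝ) ^ (-α) * √L * 2 ^ ω n) := by ring
      _ = p * ((n : ℝ) ^ (-α) * √L * 2 ^ ω n) := by
          rw [hc, div_mul_cancel₀ _ (by positivity)]
      _ ≤ _ := by gcongr
  have hq : 0 < binomProb p t ((t + 1) / 2) := lt_of_lt_of_le (by positivity) hqlow
  refine proportion_le_of_bounds hp0 hp hk hn (s := (t + 1) / 2) (by omega) hq hε ?_ ?_
  · rw [div_le_iff₀ (by positivity)] at hpown
    calc (12 : ℝ) ≤ ε * (c * 2 ^ ω n) := by linarith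
      _ = ε * ((n : ℝ) ^ α * (c * (n : ℝ) ^ (-α) * 2 ^ ω n)) := by
          rw [Real.rpow_neg hn'.le]; field_simp
      _ ≤ ε * (k * binomProb p t ((t + 1) / 2)) := by gcongr
  · have h1 : (1 : ℝ) ≤ 2 ^ ω n := Real.one_le_rpow (by norm_num) hωn
    have h2 : ((n : ℝ) ^ ((1 - α) / 2)) ^ 2 = n * (n : ℝ) ^ (-α) := by
      rw [← Real.rpow_natCast, ← Real.rpow_mul hn'.le]
      nth_rewrite 2 [← Real.rpow_one (n : ℝ)]
      rw [← Real.rpow_add hn']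
      congr 1
      push_cast
      ring
    calc 8 * (t : ℝ) ^ 2 ≤ 8 * (α / lambdaBSC p * L) ^ 2 := by gcongr
      _ = 8 * (α / lambdaBSC p) ^ 2 * L ^ 2 := by ring
      _ ≤ 8 * (α / lambdaBSC p) ^ 2 * (δ * (n : ℝ) ^ ((1 - α) / 2)) ^ 2 := by gcongr
      _ = 8 * (α / lambdaBSC p) ^ 2 * δ ^ 2 * (n * (n : ℝ) ^ (-α)) := by rw [mul_pow, h2]; ring
      _ = ε ^ 2 * c * (n * (n : ℝ) ^ (-α)) := by
          rw [hδ, Real.sq_sqrt (by positivity), mul_div_cancel₀ _ (by positivity)]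
      _ = ε ^ 2 * (n * (c * (n : ℝ) ^ (-α) * 1)) := by ring
      _ ≤ ε ^ 2 * (n * (c * (n : ℝ) ^ (-α) * 2 ^ ω n)) := by gcongr
      _ ≤ _ := by gcongr
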